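/- Let $\mathcal{B}([0,1))$ be the probability algebra of $[0,1)$: the Borel subsets of $[0,1)$ modulo Lebesgue-null sets, with metric $d(A,B)=\mu(A\triangle B)$, regarded as a metric structure with function symbols for the Boolean operations ($\emptyset$, $[0,1)$, complement, $\cap$, $\cup$) and a predicate symbol for Lebesgue measure $\mu$. A presentation of $\mathcal{B}([0,1))$ is a sequence $(a_j)_{j\in\mathbb{N}}$ in it whose generated points (the values at the $a_j$ of the terms built from the Boolean operations) are dense. Generated points are given to algorithms by terms naming them. A presentation is computable if there is an algorithm which, given a generated point $p$ and a rational $\epsilon>0$, returns a rational $r$ with $|\mu(p)-r|<\epsilon$. Two presentations $\#$ and $\dagger$ are computably isomorphic if there is an automorphism $\Phi$ of $\mathcal{B}([0,1))$ (a bijection preserving the Boolean operations and $\mu$) and there are algorithms which, given a generated point $p$ of $\#$ (respectively, of $\dagger$) and a rational $\epsilon>0$, return a generated point $q$ of $\dagger$ (respectively, of $\#$) with $d(\Phi(p),q)<\epsilon$ (respectively, $d(\Phi^{-1}(p),q)<\epsilon$). Theorem. $\mathcal{B}([0,1))$ is computably categorical, that is, it has a unique computable presentation up to computable isomorphism: it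 has a computable presentation, and any two computable presentations of $\mathcal{B}([0,1))$ are computably isomorphic. -/

import Mathlib

open MeasureTheory
open scoped symmDiff

/-! ### The probability algebra of `[0,1)` -/

/-- The interval `[0,1)`, with its Borel sets. -/
abbrev UnitIco : Type := Set.Ico (0 : ℝ) 1

/-- Lebesgue measure on `[0,1)`. -/
noncomputable abbrev UnitIco.leb : Measure UnitIco := (volume : Measure ℝ).comap Subtype.val

instance UnitIco.isProbabilityMeasure : IsProbabilityMeasure UnitIco.leb :=
  ⟨by
    rw [comap_subtype_coe_apply measurableSet_Ico, Set.image_univ, Subtype.range_coe]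
    simp⟩

/-- The Borel subsets of `[0,1)`, with the pseudometric `d(A,B) = μ(A ∆ B)`. -/
abbrev BorelIco : Type := MeasuredSets UnitIco.leb

/-- The probability algebra `𝓑([0,1))`: Borel subsets of `[0,1)`, two of them being identified
when `μ(A ∆ B) = 0`, with the metric `d(A,B) = μ(A ∆ B)`. -/
abbrev ProbAlg : Type := SeparationQuotient BorelIco

namespace ProbAlg

theorem inseparable_iff_ae (s t : BorelIco) :
    Inseparable s t ↔ (s : Set UnitIco) =ᵐ[UnitIco.leb] (t : Set UnitIco) := by
  rw [Metric.inseparable_iff, MeasuredSets.dist_def, measureReal_eq_zero_iff,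
    measure_symmDiff_eq_zero_iff]

/-- The class of a Borel set. -/
noncomputable def mk (s : Set UnitIco) (hs : MeasurableSet s) : ProbAlg :=
  SeparationQuotient.mk (⟨s, hs⟩ : BorelIco)

theorem mk_eq_mk {s t : Set UnitIco} {hs : MeasurableSet s} {ht : MeasurableSet t}
    (h : s =ᵐ[UnitIco.leb] t) : mk s hs = mk t ht :=
  SeparationQuotient.mk_eq_mk.2 ((inseparable_iff_ae _ _).2 h)

noncomputable instance : Bot ProbAlg := ⟨mk ∅ MeasurableSet.empty⟩

noncomputable instance : Top ProbAlg := ⟨mk Set.univ MeasurableSet.univ⟩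

noncomputable instance : Compl ProbAlg :=
  ⟨SeparationQuotient.lift (fun s : BorelIco => mk (s : Set UnitIco)ᶜ s.2.compl)
    fun s t h => mk_eq_mk ((inseparable_iff_ae s t).1 h).compl⟩

noncomputable instance : Min ProbAlg :=
  ⟨SeparationQuotient.lift₂
    (fun s t : BorelIco => mk ((s : Set UnitIco) ∩ (t : Set UnitIco)) (s.2.inter t.2))
    fun s t s' t' h h' =>
      mk_eq_mk (((inseparable_iff_ae s s').1 h).inter ((inseparable_iff_ae t t').1 h'))⟩

noncomputable instance : Max ProbAlg :=
  ⟨SeparationQuotient.lift₂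
    (fun s t : BorelIco => mk ((s : Set UnitIco) ∪ (t : Set UnitIco)) (s.2.union t.2))
    fun s t s' t' h h' =>
      mk_eq_mk (((inseparable_iff_ae s s').1 h).union ((inseparable_iff_ae t t').1 h'))⟩

/-- The measure of an element of the probability algebra. -/
noncomputable def meas : ProbAlg → ℝ :=
  SeparationQuotient.lift (fun s : BorelIco => UnitIco.leb.real (s : Set UnitIco))
    fun s t h => measureReal_congr ((inseparable_iff_ae s t).1 h)

/-- An automorphism of `𝓑([0,1))` in the language of probability algebras: a bijection that
preserves the Boolean operations and the measure. -/
structure Iso extends ProbAlg ≃ ProbAlg where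
  map_bot' : toFun ⊥ = ⊥
  map_top' : toFun ⊤ = ⊤
  map_compl' : ∀ A, toFun Aᶜ = (toFun A)ᶜ
  map_inf' : ∀ A B, toFun (A ⊓ B) = toFun A ⊓ toFun B
  map_sup' : ∀ A B, toFun (A ⊔ B) = toFun A ⊔ toFun B
  map_meas' : ∀ A, meas (toFun A) = meas A

end ProbAlg

/-! ### Terms in the language of probability algebras, and their codes -/

/-- Terms built from the variables `x₀, x₁, …` with the function symbols of the language. -/
inductive BTerm : Type
  | bot : BTerm
  | top : BTerm
  | var : ℕ → BTerm
  | compl : BTerm → BTerm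
  | inf : BTerm → BTerm → BTerm
  | sup : BTerm → BTerm → BTerm

namespace BTerm

/-- The code of a term. -/
def toNat : BTerm → ℕ
  | bot => 0
  | top => 1
  | var n => 4 * n + 2
  | compl t => 4 * t.toNat + 3
  | inf s t => 4 * Nat.pair s.toNat t.toNat + 4
  | sup s t => 4 * Nat.pair s.toNat t.toNat + 5

/-- The term with a given code. -/
def ofNat : ℕ → BTerm
  | 0 => bot
  | 1 => top
  | n + 2 =>
    have h : n / 4 < n + 2 := by omega
    have h₁ : (n / 4).unpair.1 < n + 2 := (Nat.unpair_left_le _).trans_lt h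
    have h₂ : (n / 4).unpair.2 < n + 2 := (Nat.unpair_right_le _).trans_lt h
    match n % 4 with
    | 0 => var (n / 4)
    | 1 => compl (ofNat (n / 4))
    | 2 => inf (ofNat (n / 4).unpair.1) (ofNat (n / 4).unpair.2)
    | _ => sup (ofNat (n / 4).unpair.1) (ofNat (n / 4).unpair.2)

theorem ofNat_toNat (t : BTerm) : ofNat t.toNat = t := by
  induction t with
  | bot => simp [toNat, ofNat]
  | top => simp [toNat, ofNat]
  | var n =>
    have h1 : 4 * n / 4 = n := by omega
    have h2 : 4 * n % 4 = 0 := by omega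
    simp only [toNat, ofNat, h1, h2]
  | compl t ih =>
    have h1 : (4 * t.toNat + 1) / 4 = t.toNat := by omega
    have h2 : (4 * t.toNat + 1) % 4 = 1 := by omega
    simp only [toNat, ofNat, h1, h2, ih]
  | inf s t ihs iht =>
    have h1 : (4 * Nat.pair s.toNat t.toNat + 2) / 4 = Nat.pair s.toNat t.toNat := by omega
    have h2 : (4 * Nat.pair s.toNat t.toNat + 2) % 4 = 2 := by omega
    simp only [toNat, ofNat, h1, h2, Nat.unpair_pair, ihs, iht]
  | sup s t ihs iht =>
    have h1 : (4 * Nat.pair s.toNat t.toNat + 3) / 4 = Nat.pair s.toNat t.toNat := by omega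
    have h2 : (4 * Nat.pair s.toNat t.toNat + 3) % 4 = 3 := by omega
    simp only [toNat, ofNat, h1, h2, Nat.unpair_pair, ihs, iht]

theorem toNat_ofNat (n : ℕ) : (ofNat n).toNat = n := by
  induction n using Nat.strong_induction_on with
  | _ n ih =>
    match n with
    | 0 => simp [toNat, ofNat]
    | 1 => simp [toNat, ofNat]
    | n + 2 =>
      have h : n / 4 < n + 2 := by omega
      have ih₀ := ih _ h
      have ih₁ := ih _ ((Nat.unpair_left_le _).trans_lt h)
      have ih₂ := ih _ ((Nat.unpair_right_le _).trans_lt h)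
      have hc : n % 4 = 0 ∨ n % 4 = 1 ∨ n % 4 = 2 ∨ n % 4 = 3 := by omega
      rcases hc with hc | hc | hc | hc <;>
        simp only [ofNat, hc, toNat, ih₀, ih₁, ih₂, Nat.pair_unpair] <;> omega

/-- Terms are numbered by their codes; computability of functions of terms refers to codes. -/
instance : Denumerable BTerm :=
  Denumerable.mk' ⟨toNat, ofNat, ofNat_toNat, toNat_ofNat⟩

/-- The value of a term when the variable `xₙ` stands for `a n`. -/
noncomputable def eval (a : ℕ → ProbAlg) : BTerm → ProbAlg
  | bot => ⊥
  | top => ⊤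
  | var n => a n
  | compl t => (t.eval a)ᶜ
  | inf s t => s.eval a ⊓ t.eval a
  | sup s t => s.eval a ⊔ t.eval a

end BTerm

/-! ### Presentations -/

/-- Codes for rational numbers. -/
abbrev RatCode : Type := ℕ × ℕ × ℕ

/-- The rational number `(m - n) / (k + 1)` with code `(m, n, k)`; every rational number has a
code. -/
def RatCode.val (c : RatCode) : ℚ := ((c.1 : ℚ) - (c.2.1 : ℚ)) / ((c.2.2 : ℚ) + 1)

/-- A presentation of `𝓑([0,1))`: a sequence of special points whose generated points (the values
of terms at the special points) are dense. -/
structure Presentation where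
  special : ℕ → ProbAlg
  dense_generated : Dense (Set.range fun t : BTerm => t.eval special)

namespace Presentation

/-- The generated point named by a term. -/
noncomputable def gen (P : Presentation) (t : BTerm) : ProbAlg := t.eval P.special

/-- There is an algorithm that, given a generated point `p` (named by a term) and a rational
`ε > 0`, returns a rational `r` with `|μ(p) - r| < ε`. -/
def IsComputable (P : Presentation) : Prop :=
  ∃ alg : BTerm → RatCode → RatCode, Computable₂ alg ∧
    ∀ (t : BTerm) (ε : RatCode), 0 < ε.val →
      |(P.gen t).meas - ((alg t ε).val : ℝ)| < (ε.val : ℝ)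

/-- There is an algorithm that, given a generated point `p` of `P` and a rational `ε > 0`,
returns a generated point `q` of `Q` with `d(f(p), q) < ε`. -/
def IsComputableMap (P Q : Presentation) (f : ProbAlg → ProbAlg) : Prop :=
  ∃ alg : BTerm → RatCode → BTerm, Computable₂ alg ∧
    ∀ (t : BTerm) (ε : RatCode), 0 < ε.val →
      dist (f (P.gen t)) (Q.gen (alg t ε)) < (ε.val : ℝ)

/-- There is an isomorphism that is a computable map in both directions. -/
def ComputablyIsomorphic (P Q : Presentation) : Prop :=
  ∃ Φ : ProbAlg.Iso,
    IsComputableMap P Q Φ.toEquiv ∧ IsComputableMap Q P Φ.toEquiv.symm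

end Presentation

/-!
The proof compares every computable presentation with a standard one, whose special points are the
intervals `[0, q)` with `q` a rational number in `[0,1)`. A set named by a term in these intervals
is a union of cells of a grid, so its measure is found exactly by counting
(`StandardPresentation.isComputable_standard`). Computable isomorphism being symmetric and
transitive, it remains to relate the standard presentation to a computable presentation `P`.

Let `Aₙ` be Borel sets representing the special points of `P`, and let `f` send a point `x` to the
real number whose ternary digits are the truth values of `x ∈ Aₙ`; the order of the values of `f` is
the lexicographic order of these sequences. As the generated points of `P` are dense, every Borel
set is, modulo null sets, a preimage under `f` (`Presentation.generating_digitFunction`), and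
therefore the law of `f` has no atoms. Let `F` be its distribution function. Then `F ∘ f` preserves
Lebesgue measure, and `F` is injective off a null set, so that (images of Borel sets under
injective Borel maps being Borel) taking preimages under `F ∘ f` is an automorphism of `𝓑([0,1))`.

This automorphism sends `[0, q)` to `{F ∘ f < q}`, the initial segment of measure `q` in the
lexicographic order. For a finite binary sequence `σ`, the set of points lexicographically below `σ`
is named by a term, `BTerm.lexLower 0 σ`. Any two initial segments are comparable, so the distance
between two of them is the difference of their measures. Hence the image of `[0, q)` can be
approximated by searching for some `σ` such that the measure of its segment, which can be computed
in `P`, is close to `q`. Substitution for the variables extends this algorithm to all terms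
(`Presentation.isComputableMap_of_special`). The inverse of a computable automorphism is computable,
again by a search (`Presentation.IsComputableMap.symm`).
-/

/-! ### Computability of searches and of recursion on terms -/

/-- Unbounded search for a witness of a decidable property, on the inputs that satisfy a decidable
precondition. The element `d` stands for the numbers that are not codes. -/
theorem Computable.exists_search {α γ : Type*} [Primcodable α] [Primcodable γ] (d : γ)
    {q : α → Bool} {p : α → γ → Bool} (hq : Computable q) (hp : Computable₂ p)
    (h : ∀ a, q a = true → ∃ c, p a c = true) :
    ∃ f : α → γ, Computable f ∧ ∀ a, q a = true → p a (f a) = true := by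
  let e : ℕ → γ := fun n => (Encodable.decode n : Option γ).getD d
  have he : Computable e := Computable.option_getD Computable.decode (Computable.const d)
  have hp' : Computable₂ fun (a : α) (n : ℕ) => (bif q a then p a (e n) else true) :=
    Computable.cond (hq.comp Computable.fst)
      (hp.comp Computable.fst (he.comp Computable.snd)) (Computable.const true)
  have h' : ∀ a, ∃ n : ℕ, (bif q a then p a (e n) else true) = true := by
    intro a
    cases hqa : q a with
    | false => exact ⟨0, rfl⟩
    | true =>
      obtain ⟨c, hc⟩ := h a hqa
      exact ⟨Encodable.encode c, by simpa [e] using hc⟩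
  refine ⟨fun a => e (Nat.find (h' a)), he.comp ?_, ?_⟩
  · refine (Partrec.rfind hp'.partrec₂).of_eq_tot fun a => ?_
    rw [Nat.mem_rfind]
    refine ⟨by simpa using Nat.find_spec (h' a), fun {m} hm => ?_⟩
    simpa using Nat.find_min (h' a) hm
  · intro a hqa
    have hn : ∀ n : ℕ, (bif q a then p a (e n) else true) = true → p a (e n) = true :=
      fun n hn => by rwa [hqa] at hn
    exact hn _ (Nat.find_spec (h' a))

namespace BTerm

/-- Recursion on terms: the value of a term in an algebra with carrier `σ`, where the variable
`xₙ` stands for `v n`. -/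
def fold {σ : Type*} (b t : σ) (v : ℕ → σ) (c : σ → σ) (i s : σ → σ → σ) : BTerm → σ
  | bot => b
  | top => t
  | var n => v n
  | compl r => c (fold b t v c i s r)
  | inf r r' => i (fold b t v c i s r) (fold b t v c i s r')
  | sup r r' => s (fold b t v c i s r) (fold b t v c i s r')

theorem encode_eq_toNat (t : BTerm) : Encodable.encode t = t.toNat := rfl

/-- Recursion on terms is course-of-values recursion on their codes, so it preserves
computability. -/
theorem computable_fold {α σ : Type*} [Primcodable α] [Primcodable σ] (b t : σ) {v : α → ℕ → σ}
    {c : σ → σ} {i s : σ → σ → σ} (hv : Computable₂ v) (hc : Computable c) (hi : Computable₂ i)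
    (hs : Computable₂ s) : Computable₂ fun a r => fold b t (v a) c i s r := by
  let g : α → List σ → Option σ := fun a l =>
    cond (l.length == 0) (some b) <| cond (l.length == 1) (some t) <|
    cond ((l.length - 2) % 4 == 0) (some (v a ((l.length - 2) / 4))) <|
    cond ((l.length - 2) % 4 == 1) ((l[(l.length - 2) / 4]?).map c) <|
    cond ((l.length - 2) % 4 == 2)
      ((l[((l.length - 2) / 4).unpair.1]?).bind fun x =>
        (l[((l.length - 2) / 4).unpair.2]?).map fun y => i x y)
      ((l[((l.length - 2) / 4).unpair.1]?).bind fun x =>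
        (l[((l.length - 2) / 4).unpair.2]?).map fun y => s x y)
  have hlen : Primrec fun p : α × List σ => p.2.length := Primrec.list_length.comp Primrec.snd
  have hsub : Primrec fun p : α × List σ => p.2.length - 2 :=
    Primrec.nat_sub.comp hlen (Primrec.const 2)
  have hdiv : Primrec fun p : α × List σ => (p.2.length - 2) / 4 :=
    Primrec.nat_div.comp hsub (Primrec.const 4)
  have hmod : Primrec fun p : α × List σ => (p.2.length - 2) % 4 :=
    Primrec.nat_mod.comp hsub (Primrec.const 4)
  have hbeq : ∀ {f : α × List σ → ℕ} (k : ℕ), Primrec f → Computable fun p => f p == k :=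
    fun k hf => (Primrec.beq.comp hf (Primrec.const k)).to_comp
  have hget : ∀ {f : α × List σ → ℕ}, Primrec f → Computable fun p => p.2[f p]? :=
    fun hf => (Primrec.list_getElem?.comp Primrec.snd hf).to_comp
  have hun : Primrec fun p : α × List σ => ((p.2.length - 2) / 4).unpair :=
    Primrec.unpair.comp hdiv
  have hbin : ∀ {o : σ → σ → σ}, Computable₂ o → Computable fun p : α × List σ =>
      ((p.2[((p.2.length - 2) / 4).unpair.1]?).bind fun x =>
        (p.2[((p.2.length - 2) / 4).unpair.2]?).map fun y => o x y) := fun ho =>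
    Computable.option_bind (hget (Primrec.fst.comp hun)) <| Computable.option_map
      ((hget (Primrec.snd.comp hun)).comp Computable.fst)
      (ho.comp (Computable.snd.comp Computable.fst) Computable.snd)
  have hg : Computable₂ g :=
    Computable.cond (hbeq 0 hlen) (Computable.const _) <|
    Computable.cond (hbeq 1 hlen) (Computable.const _) <|
    Computable.cond (hbeq 0 hmod)
      (Computable.option_some.comp (hv.comp Computable.fst hdiv.to_comp)) <|
    Computable.cond (hbeq 1 hmod)
      (Computable.option_map (hget hdiv) (hc.comp Computable.snd)) <|
    Computable.cond (hbeq 2 hmod) (hbin hi) (hbin hs)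
  have key : Computable₂ fun a n => fold b t (v a) c i s (ofNat n) := by
    refine Computable.nat_strong_rec _ hg fun a n => ?_
    match n with
    | 0 => simp [g, ofNat, fold]
    | 1 => simp [g, ofNat, fold]
    | n + 2 =>
      have h : n / 4 < n + 2 := by omega
      have h₁ : (n / 4).unpair.1 < n + 2 := (Nat.unpair_left_le _).trans_lt h
      have h₂ : (n / 4).unpair.2 < n + 2 := (Nat.unpair_right_le _).trans_lt h
      have hc : n % 4 = 0 ∨ n % 4 = 1 ∨ n % 4 = 2 ∨ n % 4 = 3 := by omega
      rcases hc with hc | hc | hc | hc <;>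
        simp [g, ofNat, fold, hc, h, h₁, h₂]
  refine (key.comp Computable.fst (Computable.encode.comp Computable.snd)).of_eq fun p => ?_
  rw [encode_eq_toNat, ofNat_toNat]

theorem primrec_var : Primrec var := by
  refine Primrec.encode_iff.1 ?_
  exact Primrec.nat_add.comp (Primrec.nat_mul.comp (Primrec.const 4) Primrec.id) (Primrec.const 2)

theorem primrec_compl : Primrec compl := by
  refine Primrec.encode_iff.1 ?_
  exact Primrec.nat_add.comp (Primrec.nat_mul.comp (Primrec.const 4) Primrec.encode)
    (Primrec.const 3)

theorem primrec_inf : Primrec₂ inf := by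
  refine Primrec.encode_iff.1 ?_
  exact Primrec.nat_add.comp (Primrec.nat_mul.comp (Primrec.const 4)
    (Primrec₂.natPair.comp (Primrec.encode.comp Primrec.fst) (Primrec.encode.comp Primrec.snd)))
    (Primrec.const 4)

theorem primrec_sup : Primrec₂ sup := by
  refine Primrec.encode_iff.1 ?_
  exact Primrec.nat_add.comp (Primrec.nat_mul.comp (Primrec.const 4)
    (Primrec₂.natPair.comp (Primrec.encode.comp Primrec.fst) (Primrec.encode.comp Primrec.snd)))
    (Primrec.const 5)

/-- The substitution of terms for variables. -/
def subst (v : ℕ → BTerm) (t : BTerm) : BTerm := fold bot top v compl inf sup t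

theorem computable_subst {α : Type*} [Primcodable α] {v : α → ℕ → BTerm} (hv : Computable₂ v) :
    Computable₂ fun a t => subst (v a) t :=
  computable_fold _ _ hv primrec_compl.to_comp primrec_inf.to_comp primrec_sup.to_comp

/-- The number of binary operation symbols in a term; one more than this bounds the number of
occurrences of variables. -/
def weight (t : BTerm) : ℕ :=
  fold 0 0 (fun _ => 0) id (fun m n => m + n + 1) (fun m n => m + n + 1) t

theorem computable_weight : Computable weight := by
  have h : Computable₂ fun m n : ℕ => m + n + 1 :=
    (Primrec.succ.comp (Primrec.nat_add.comp Primrec.fst Primrec.snd)).to_comp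
  exact (computable_fold (α := Unit) 0 0 (v := fun _ _ => 0) (Computable.const 0) Computable.id h
    h).comp (Computable.const ()) Computable.id

/-- The truth value of a term under an assignment of truth values to the variables. -/
def beval (v : ℕ → Bool) (t : BTerm) : Bool := fold false true v not and or t

theorem computable_beval {α : Type*} [Primcodable α] {v : α → ℕ → Bool} (hv : Computable₂ v) :
    Computable₂ fun a t => beval (v a) t :=
  computable_fold _ _ hv Primrec.not.to_comp Primrec.and.to_comp Primrec.or.to_comp

/-- The term for the symmetric difference. -/
def sdiff (s t : BTerm) : BTerm := sup (inf s (compl t)) (inf (compl s) t)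

theorem computable_sdiff : Computable₂ sdiff :=
  (primrec_sup.comp
    (primrec_inf.comp Primrec.fst (primrec_compl.comp Primrec.snd))
    (primrec_inf.comp (primrec_compl.comp Primrec.fst) Primrec.snd)).to_comp

end BTerm

/-! ### Arithmetic on codes for rational numbers -/

namespace RatCode

/-- The quotient of a rational number by `d + 1`. -/
def divSucc (c : RatCode) (d : ℕ) : RatCode := (c.1, c.2.1, c.2.2 * d + c.2.2 + d)

theorem val_divSucc (c : RatCode) (d : ℕ) : (c.divSucc d).val = c.val / (d + 1) := by
  simp only [divSucc, val]
  rw [div_div]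
  congr 1
  push_cast
  ring

/-- The sum of two rational numbers. -/
def add (c d : RatCode) : RatCode :=
  (c.1 * (d.2.2 + 1) + d.1 * (c.2.2 + 1), c.2.1 * (d.2.2 + 1) + d.2.1 * (c.2.2 + 1),
    c.2.2 * d.2.2 + c.2.2 + d.2.2)

theorem val_add (c d : RatCode) : (c.add d).val = c.val + d.val := by
  have h : (c.2.2 : ℚ) + 1 ≠ 0 := by positivity
  have h' : (d.2.2 : ℚ) + 1 ≠ 0 := by positivity
  simp only [add, val]
  rw [div_add_div _ _ h h']
  congr 1 <;> (push_cast; ring)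

/-- The order of the rational numbers, as a Boolean function of codes. -/
def lt (c d : RatCode) : Bool :=
  decide (c.1 * (d.2.2 + 1) + d.2.1 * (c.2.2 + 1) < d.1 * (c.2.2 + 1) + c.2.1 * (d.2.2 + 1))

theorem lt_iff (c d : RatCode) : c.lt d = true ↔ c.val < d.val := by
  have h : (0 : ℚ) < (c.2.2 : ℚ) + 1 := by positivity
  have h' : (0 : ℚ) < (d.2.2 : ℚ) + 1 := by positivity
  simp only [lt, val, decide_eq_true_eq]
  rw [div_lt_div_iff₀ h h', ← @Nat.cast_lt ℚ]
  push_cast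
  constructor <;> intro H <;> linarith

/-- Positivity of a rational number, as a Boolean function of its code. -/
def isPos (c : RatCode) : Bool := lt (0, 0, 0) c

theorem isPos_iff (c : RatCode) : c.isPos = true ↔ 0 < c.val := by
  rw [isPos, lt_iff]
  simp [val]

theorem primrec_num : Primrec fun c : RatCode => c.1 := Primrec.fst
theorem primrec_sub : Primrec fun c : RatCode => c.2.1 := Primrec.fst.comp Primrec.snd
theorem primrec_den : Primrec fun c : RatCode => c.2.2 := Primrec.snd.comp Primrec.snd

theorem computable_divSucc : Computable₂ divSucc := by
  have h := primrec_den.comp (Primrec.fst (α := RatCode) (β := ℕ))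
  have hd := Primrec.snd (α := RatCode) (β := ℕ)
  exact ((primrec_num.comp Primrec.fst).pair ((primrec_sub.comp Primrec.fst).pair
    (Primrec.nat_add.comp (Primrec.nat_add.comp (Primrec.nat_mul.comp h hd) h) hd))).to_comp

theorem computable_add : Computable₂ add := by
  have h₁ := primrec_den.comp (Primrec.fst (α := RatCode) (β := RatCode))
  have h₂ := primrec_den.comp (Primrec.snd (α := RatCode) (β := RatCode))
  have s₁ := Primrec.succ.comp h₁
  have s₂ := Primrec.succ.comp h₂
  exact ((Primrec.nat_add.comp (Primrec.nat_mul.comp (primrec_num.comp Primrec.fst) s₂)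
    (Primrec.nat_mul.comp (primrec_num.comp Primrec.snd) s₁)).pair
    ((Primrec.nat_add.comp (Primrec.nat_mul.comp (primrec_sub.comp Primrec.fst) s₂)
      (Primrec.nat_mul.comp (primrec_sub.comp Primrec.snd) s₁)).pair
    (Primrec.nat_add.comp (Primrec.nat_add.comp (Primrec.nat_mul.comp h₁ h₂) h₁) h₂))).to_comp

theorem computable_lt : Computable₂ lt := by
  have s₁ := Primrec.succ.comp (primrec_den.comp (Primrec.fst (α := RatCode) (β := RatCode)))
  have s₂ := Primrec.succ.comp (primrec_den.comp (Primrec.snd (α := RatCode) (β := RatCode)))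
  exact (Primrec.nat_lt.comp
    (Primrec.nat_add.comp (Primrec.nat_mul.comp (primrec_num.comp Primrec.fst) s₂)
      (Primrec.nat_mul.comp (primrec_sub.comp Primrec.snd) s₁))
    (Primrec.nat_add.comp (Primrec.nat_mul.comp (primrec_num.comp Primrec.snd) s₁)
      (Primrec.nat_mul.comp (primrec_sub.comp Primrec.fst) s₂))).decide.to_comp

theorem computable_isPos : Computable isPos :=
  computable_lt.comp (Computable.const _) Computable.id

end RatCode

/-! ### The metric of the probability algebra -/

namespace ProbAlg

theorem ind {p : ProbAlg → Prop} (h : ∀ s hs, p (mk s hs)) (A : ProbAlg) : p A := by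
  obtain ⟨s, rfl⟩ := SeparationQuotient.surjective_mk A
  exact h s.1 s.2

theorem compl_mk {s : Set UnitIco} (hs : MeasurableSet s) : (mk s hs)ᶜ = mk sᶜ hs.compl := rfl

theorem inf_mk {s t : Set UnitIco} (hs : MeasurableSet s) (ht : MeasurableSet t) :
    mk s hs ⊓ mk t ht = mk (s ∩ t) (hs.inter ht) := rfl

theorem sup_mk {s t : Set UnitIco} (hs : MeasurableSet s) (ht : MeasurableSet t) :
    mk s hs ⊔ mk t ht = mk (s ∪ t) (hs.union ht) := rfl

theorem meas_mk {s : Set UnitIco} (hs : MeasurableSet s) :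
    (mk s hs).meas = UnitIco.leb.real s := rfl

theorem dist_mk {s t : Set UnitIco} (hs : MeasurableSet s) (ht : MeasurableSet t) :
    dist (mk s hs) (mk t ht) = UnitIco.leb.real (s ∆ t) := rfl

theorem dist_eq_meas (A B : ProbAlg) : dist A B = ((A ⊓ Bᶜ) ⊔ (Aᶜ ⊓ B)).meas := by
  induction A using ind with
  | _ s hs =>
  induction B using ind with
  | _ t ht =>
  rw [dist_mk, compl_mk, compl_mk, inf_mk, inf_mk, sup_mk, meas_mk, Set.symmDiff_def,
    Set.sdiff_eq, Set.sdiff_eq, Set.inter_comm t]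

/-- The distance between two comparable sets is the difference of their measures. -/
theorem dist_mk_of_subset_or_subset {s t : Set UnitIco} (hs : MeasurableSet s)
    (ht : MeasurableSet t) (h : s ⊆ t ∨ t ⊆ s) :
    dist (mk s hs) (mk t ht) = |UnitIco.leb.real s - UnitIco.leb.real t| := by
  wlog h' : s ⊆ t generalizing s t
  · rw [dist_comm, abs_sub_comm]
    exact this ht hs h.symm (h.resolve_left h')
  rw [dist_mk, symmDiff_of_le h', measureReal_sdiff h' hs, abs_sub_comm,
    abs_of_nonneg (sub_nonneg.2 (measureReal_mono h'))]

theorem dist_compl (A B : ProbAlg) : dist Aᶜ Bᶜ = dist A B := by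
  induction A using ind with
  | _ s hs =>
  induction B using ind with
  | _ t ht => rw [compl_mk, compl_mk, dist_mk, dist_mk, compl_symmDiff_compl]

theorem dist_inf_le (A B A' B' : ProbAlg) :
    dist (A ⊓ B) (A' ⊓ B') ≤ dist A A' + dist B B' := by
  induction A using ind with
  | _ s hs =>
  induction B using ind with
  | _ t ht =>
  induction A' using ind with
  | _ s' hs' =>
  induction B' using ind with
  | _ t' ht' =>
  rw [inf_mk, inf_mk, dist_mk, dist_mk, dist_mk]
  refine (measureReal_mono ?_).trans (measureReal_union_le _ _)
  intro x
  simp only [Set.mem_symmDiff, Set.mem_inter_iff, Set.mem_union]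
  tauto

theorem dist_sup_le (A B A' B' : ProbAlg) :
    dist (A ⊔ B) (A' ⊔ B') ≤ dist A A' + dist B B' := by
  induction A using ind with
  | _ s hs =>
  induction B using ind with
  | _ t ht =>
  induction A' using ind with
  | _ s' hs' =>
  induction B' using ind with
  | _ t' ht' =>
  rw [sup_mk, sup_mk, dist_mk, dist_mk, dist_mk]
  refine (measureReal_mono ?_).trans (measureReal_union_le _ _)
  intro x
  simp only [Set.mem_symmDiff, Set.mem_union]
  tauto

namespace Iso

theorem apply_eval (Φ : Iso) (a : ℕ → ProbAlg) (t : BTerm) :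
    Φ.toFun (t.eval a) = t.eval fun n => Φ.toFun (a n) := by
  induction t with
  | bot => exact Φ.map_bot'
  | top => exact Φ.map_top'
  | var n => rfl
  | compl t ih => simp only [BTerm.eval, Φ.map_compl', ih]
  | inf s t ihs iht => simp only [BTerm.eval, Φ.map_inf', ihs, iht]
  | sup s t ihs iht => simp only [BTerm.eval, Φ.map_sup', ihs, iht]

theorem dist_apply (Φ : Iso) (A B : ProbAlg) : dist (Φ.toEquiv A) (Φ.toEquiv B) = dist A B := by
  change dist (Φ.toFun A) (Φ.toFun B) = _
  rw [dist_eq_meas, dist_eq_meas, ← Φ.map_compl', ← Φ.map_compl', ← Φ.map_inf', ← Φ.map_inf',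
    ← Φ.map_sup', Φ.map_meas']

/-- The inverse of an automorphism. -/
def symm (Φ : Iso) : Iso where
  toEquiv := Φ.toEquiv.symm
  map_bot' := Φ.toEquiv.symm_apply_eq.2 Φ.map_bot'.symm
  map_top' := Φ.toEquiv.symm_apply_eq.2 Φ.map_top'.symm
  map_compl' A := Φ.toEquiv.symm_apply_eq.2 <| by
    refine Eq.trans ?_ (Φ.map_compl' _).symm
    exact congrArg _ (Φ.toEquiv.apply_symm_apply A).symm
  map_inf' A B := Φ.toEquiv.symm_apply_eq.2 <| by
    refine Eq.trans ?_ (Φ.map_inf' _ _).symm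
    exact congrArg₂ _ (Φ.toEquiv.apply_symm_apply A).symm (Φ.toEquiv.apply_symm_apply B).symm
  map_sup' A B := Φ.toEquiv.symm_apply_eq.2 <| by
    refine Eq.trans ?_ (Φ.map_sup' _ _).symm
    exact congrArg₂ _ (Φ.toEquiv.apply_symm_apply A).symm (Φ.toEquiv.apply_symm_apply B).symm
  map_meas' A := by
    refine (Φ.map_meas' _).symm.trans ?_
    exact congrArg _ (Φ.toEquiv.apply_symm_apply A)

/-- The composite of two automorphisms. -/
def trans (Φ Ψ : Iso) : Iso where
  toEquiv := Φ.toEquiv.trans Ψ.toEquiv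
  map_bot' := (congrArg Ψ.toFun Φ.map_bot').trans Ψ.map_bot'
  map_top' := (congrArg Ψ.toFun Φ.map_top').trans Ψ.map_top'
  map_compl' A := (congrArg Ψ.toFun (Φ.map_compl' A)).trans (Ψ.map_compl' _)
  map_inf' A B := (congrArg Ψ.toFun (Φ.map_inf' A B)).trans (Ψ.map_inf' _ _)
  map_sup' A B := (congrArg Ψ.toFun (Φ.map_sup' A B)).trans (Ψ.map_sup' _ _)
  map_meas' A := (Ψ.map_meas' _).trans (Φ.map_meas' A)

end Iso

end ProbAlg

/-! ### Values of terms -/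

namespace BTerm

open ProbAlg

/-- The set named by a term when the variable `xₙ` stands for the set `A n`. -/
def setEval {X : Type*} (A : ℕ → Set X) (t : BTerm) : Set X :=
  fold ∅ Set.univ A (·ᶜ) (· ∩ ·) (· ∪ ·) t

theorem measurableSet_setEval {X : Type*} [MeasurableSpace X] {A : ℕ → Set X}
    (hA : ∀ n, MeasurableSet (A n)) (t : BTerm) : MeasurableSet (t.setEval A) := by
  induction t with
  | bot => exact MeasurableSet.empty
  | top => exact MeasurableSet.univ
  | var n => exact hA n
  | compl t ih => exact ih.compl
  | inf s t ihs iht => exact ihs.inter iht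
  | sup s t ihs iht => exact ihs.union iht

theorem eval_mk {A : ℕ → Set UnitIco} (hA : ∀ n, MeasurableSet (A n)) (t : BTerm) :
    t.eval (fun n => mk (A n) (hA n)) = mk (t.setEval A) (measurableSet_setEval hA t) := by
  induction t with
  | bot => rfl
  | top => rfl
  | var n => rfl
  | compl t ih => rw [eval, ih]; rfl
  | inf s t ihs iht => rw [eval, ihs, iht]; rfl
  | sup s t ihs iht => rw [eval, ihs, iht]; rfl

theorem eval_subst (a : ℕ → ProbAlg) (v : ℕ → BTerm) (t : BTerm) :
    (t.subst v).eval a = t.eval fun n => (v n).eval a := by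
  induction t with
  | bot => rfl
  | top => rfl
  | var n => rfl
  | compl t ih => exact congrArg _ ih
  | inf s t ihs iht => exact congrArg₂ (· ⊓ ·) ihs iht
  | sup s t ihs iht => exact congrArg₂ (· ⊔ ·) ihs iht

theorem dist_eval_lt {a b : ℕ → ProbAlg} {δ : ℝ} (h : ∀ n, dist (a n) (b n) < δ) (t : BTerm) :
    dist (t.eval a) (t.eval b) < (t.weight + 1) * δ := by
  have hδ : 0 < δ := dist_nonneg.trans_lt (h 0)
  induction t with
  | bot => simpa [eval, weight, fold] using hδ
  | top => simpa [eval, weight, fold] using hδ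
  | var n => simpa [eval, weight, fold] using h n
  | compl t ih => simpa only [eval, dist_compl] using! ih
  | inf s t ihs iht =>
    refine (dist_inf_le _ _ _ _).trans_lt ?_
    change _ < (((s.weight + t.weight + 1 : ℕ) : ℝ) + 1) * δ
    push_cast
    linarith
  | sup s t ihs iht =>
    refine (dist_sup_le _ _ _ _).trans_lt ?_
    change _ < (((s.weight + t.weight + 1 : ℕ) : ℝ) + 1) * δ
    push_cast
    linarith

end BTerm

/-! ### Computable maps between presentations -/

namespace Presentation

open ProbAlg

theorem IsComputableMap.comp {P Q R : Presentation} {f g : ProbAlg → ProbAlg}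
    (hg : IsComputableMap Q R g) (hf : IsComputableMap P Q f)
    (hdist : ∀ A B, dist (g A) (g B) = dist A B) : IsComputableMap P R (g ∘ f) := by
  obtain ⟨α, hα, hα'⟩ := hf
  obtain ⟨β, hβ, hβ'⟩ := hg
  have half : Computable₂ fun (_ : BTerm) (ε : RatCode) => ε.divSucc 1 :=
    RatCode.computable_divSucc.comp Computable.snd (Computable.const 1)
  refine ⟨fun t ε => β (α t (ε.divSucc 1)) (ε.divSucc 1),
    hβ.comp (hα.comp Computable.fst half) half, fun t ε hε => ?_⟩
  have hv : ((ε.divSucc 1).val : ℝ) = ε.val / 2 := by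
    rw [RatCode.val_divSucc]; push_cast; norm_num
  have hpos : 0 < (ε.divSucc 1).val := by
    rw [RatCode.val_divSucc]; positivity
  have h₁ := hα' t _ hpos
  have h₂ := hβ' (α t (ε.divSucc 1)) _ hpos
  rw [← hdist] at h₁
  rw [hv] at h₁ h₂
  calc _ ≤ _ := dist_triangle _ (g (Q.gen (α t (ε.divSucc 1)))) _
    _ < _ := by simp only [Function.comp_apply]; linarith

/-- A map commuting with the values of terms is computable if its values at the special points
are, since the error of a term is at most the error at the variables times their number of
occurrences. -/
theorem isComputableMap_of_special {P Q : Presentation} {f : ProbAlg → ProbAlg}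
    (hf : ∀ t : BTerm, f (P.gen t) = t.eval fun n => f (P.special n))
    (h : ∃ alg : ℕ → RatCode → BTerm, Computable₂ alg ∧ ∀ (n : ℕ) (ε : RatCode), 0 < ε.val →
      dist (f (P.special n)) (Q.gen (alg n ε)) < (ε.val : ℝ)) : IsComputableMap P Q f := by
  obtain ⟨α, hα, hα'⟩ := h
  have hδ : Computable fun p : BTerm × RatCode => p.2.divSucc p.1.weight :=
    RatCode.computable_divSucc.comp Computable.snd (BTerm.computable_weight.comp Computable.fst)
  have hv : Computable₂ fun (p : BTerm × RatCode) (n : ℕ) => α n (p.2.divSucc p.1.weight) :=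
    hα.comp Computable.snd (hδ.comp Computable.fst)
  have hs : Computable fun p : BTerm × RatCode => p.1.subst fun n => α n (p.2.divSucc p.1.weight) :=
    (BTerm.computable_subst hv).comp Computable.id Computable.fst
  refine ⟨fun t ε => t.subst fun n => α n (ε.divSucc t.weight),
    hs, fun t ε hε => ?_⟩
  have hpos : 0 < (ε.divSucc t.weight).val := by
    rw [RatCode.val_divSucc]; positivity
  rw [hf, gen, BTerm.eval_subst]
  refine (BTerm.dist_eval_lt (fun n => hα' n _ hpos) t).trans_eq ?_
  rw [RatCode.val_divSucc]
  push_cast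
  field_simp

/-- The inverse of a computable automorphism is computable: an approximate preimage of a generated
point is found by search, the distance of its image to the given point being computable. -/
theorem IsComputableMap.symm {P Q : Presentation} (hQ : Q.IsComputable) {Φ : Iso}
    (h : IsComputableMap P Q Φ.toEquiv) : IsComputableMap Q P Φ.toEquiv.symm := by
  obtain ⟨μ, hμ, hμ'⟩ := hQ
  obtain ⟨α, hα, hα'⟩ := h
  -- The image and the distance are computed to within `ε / 8`. A term whose computed distance is
  -- less than `ε / 2` is then correct, and one at distance less than `ε / 8` passes this test.
  let p : BTerm × RatCode → BTerm → Bool := fun a s =>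
    (μ (BTerm.sdiff (α s (a.2.divSucc 7)) a.1) (a.2.divSucc 7)).lt (a.2.divSucc 1)
  have hdiv : ∀ d : ℕ, Computable fun a : (BTerm × RatCode) × BTerm => a.1.2.divSucc d := fun d =>
    RatCode.computable_divSucc.comp (Computable.snd.comp Computable.fst) (Computable.const d)
  have hp : Computable₂ p :=
    RatCode.computable_lt.comp (hμ.comp (BTerm.computable_sdiff.comp
      (hα.comp Computable.snd (hdiv 7)) (Computable.fst.comp Computable.fst)) (hdiv 7)) (hdiv 1)
  have hgen : ∀ s t : BTerm, (Q.gen (s.sdiff t)).meas = dist (Q.gen s) (Q.gen t) := fun s t =>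
    (dist_eq_meas _ _).symm
  have hv : ∀ (ε : RatCode) (d : ℕ), ((ε.divSucc d).val : ℝ) = ε.val / (d + 1) := by
    intro ε d; rw [RatCode.val_divSucc]; push_cast; rfl
  have hpos : ∀ (ε : RatCode) (d : ℕ), 0 < ε.val → 0 < (ε.divSucc d).val := by
    intro ε d hε; rw [RatCode.val_divSucc]; positivity
  have hp_iff : ∀ a s, p a s = true ↔
      ((μ (BTerm.sdiff (α s (a.2.divSucc 7)) a.1) (a.2.divSucc 7)).val : ℝ) < a.2.val / 2 := by
    intro a s
    rw [RatCode.lt_iff, ← Rat.cast_lt (K := ℝ), hv]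
    norm_num
  obtain ⟨f, hf, hf'⟩ := Computable.exists_search BTerm.bot
    (q := fun a : BTerm × RatCode => a.2.isPos) (RatCode.computable_isPos.comp Computable.snd) hp <| by
      rintro ⟨t, ε⟩ hε
      have hε := (RatCode.isPos_iff _).1 hε
      have hε8 : (0 : ℝ) < (ε.divSucc 7).val := by exact_mod_cast hpos ε 7 hε
      obtain ⟨_, ⟨s, rfl⟩, hs⟩ :=
        Metric.dense_iff.1 P.dense_generated (Φ.toEquiv.symm (Q.gen t)) _ hε8 |>.imp
          fun _ h => h.symm
      refine ⟨s, (hp_iff _ _).2 ?_⟩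
      have h₁ := hμ' (BTerm.sdiff (α s (ε.divSucc 7)) t) _ (hpos ε 7 hε)
      have h₂ := hα' s _ (hpos ε 7 hε)
      rw [Metric.mem_ball, ← Φ.dist_apply, Equiv.apply_symm_apply] at hs
      rw [hgen] at h₁
      have h₃ := dist_triangle_left (Q.gen (α s (ε.divSucc 7))) (Q.gen t) (Φ.toEquiv (P.gen s))
      have h₄ := abs_lt.1 h₁
      change dist (Φ.toEquiv (P.gen s)) (Q.gen t) < _ at hs
      rw [hv] at *
      norm_num at *
      linarith
  refine ⟨fun t ε => f (t, ε), hf, fun t ε hε => ?_⟩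
  have h₀ := (hp_iff _ _).1 (hf' (t, ε) ((RatCode.isPos_iff _).2 hε))
  have h₁ := hμ' (BTerm.sdiff (α (f (t, ε)) (ε.divSucc 7)) t) _ (hpos ε 7 hε)
  have h₂ := hα' (f (t, ε)) _ (hpos ε 7 hε)
  rw [hgen] at h₁
  rw [hv] at h₁ h₂
  have h₃ := dist_triangle_right (Q.gen t) (Φ.toEquiv (P.gen (f (t, ε))))
    (Q.gen (α (f (t, ε)) (ε.divSucc 7)))
  rw [dist_comm (Q.gen t) (Q.gen _)] at h₃
  have h₄ := abs_lt.1 h₁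
  rw [← Φ.dist_apply, Equiv.apply_symm_apply]
  have hε' : (0 : ℝ) < ε.val := by exact_mod_cast hε
  norm_num at h₀ h₁ h₂ h₄
  linarith

theorem ComputablyIsomorphic.symm {P Q : Presentation} (h : ComputablyIsomorphic P Q) :
    ComputablyIsomorphic Q P := by
  obtain ⟨Φ, h₁, h₂⟩ := h
  exact ⟨Φ.symm, h₂, h₁⟩

theorem ComputablyIsomorphic.trans {P Q R : Presentation} (h : ComputablyIsomorphic P Q)
    (h' : ComputablyIsomorphic Q R) : ComputablyIsomorphic P R := by
  obtain ⟨Φ, h₁, h₂⟩ := h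
  obtain ⟨Ψ, h₁', h₂'⟩ := h'
  exact ⟨Φ.trans Ψ, h₁'.comp h₁ Ψ.dist_apply, h₂.comp h₂' Φ.symm.dist_apply⟩

end Presentation

/-! ### The standard presentation by intervals with rational endpoints -/

namespace UnitIco

theorem real_preimage (B : Set ℝ) :
    leb.real (Subtype.val ⁻¹' B) = volume.real (Set.Ico (0 : ℝ) 1 ∩ B) := by
  rw [measureReal_def, comap_subtype_coe_apply measurableSet_Ico, Subtype.image_preimage_coe,
    measureReal_def]

theorem real_setOf_Ico {a b : ℝ} (ha : 0 ≤ a) (hab : a ≤ b) (hb : b ≤ 1) :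
    leb.real {x : UnitIco | x.1 ∈ Set.Ico a b} = b - a := by
  have h := real_preimage (Set.Ico a b)
  rw [Set.inter_eq_self_of_subset_right (Set.Ico_subset_Ico ha hb), Real.volume_real_Ico_of_le hab]
    at h
  exact h

end UnitIco

namespace StandardPresentation

open ProbAlg

/-- The code of the right endpoint of the `n`-th interval. It is `m / (m + k + 1)` for
`n = Nat.pair m k`, so that every rational number in `[0,1)` occurs. -/
def endpoint (n : ℕ) : RatCode := (n.unpair.1, 0, n.unpair.1 + n.unpair.2)

theorem computable_endpoint : Computable endpoint := by
  have h₁ : Primrec fun n : ℕ => n.unpair.1 := Primrec.fst.comp Primrec.unpair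
  have h₂ : Primrec fun n : ℕ => n.unpair.2 := Primrec.snd.comp Primrec.unpair
  exact (h₁.pair ((Primrec.const 0).pair (Primrec.nat_add.comp h₁ h₂))).to_comp

theorem endpoint_nonneg (n : ℕ) : 0 ≤ (endpoint n).val := by
  simp only [endpoint, RatCode.val, Nat.cast_zero, sub_zero]
  positivity

theorem endpoint_lt_one (n : ℕ) : (endpoint n).val < 1 := by
  simp only [endpoint, RatCode.val, Nat.cast_zero, sub_zero]
  rw [div_lt_one (by positivity)]
  push_cast
  linarith [(n.unpair.2.cast_nonneg : (0 : ℚ) ≤ _)]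

theorem exists_endpoint_eq {q : ℚ} (h₀ : 0 ≤ q) (h₁ : q < 1) : ∃ n, (endpoint n).val = q := by
  have hnum : 0 ≤ q.num := Rat.num_nonneg.2 h₀
  have hlt : q.num < q.den := by
    have := (Rat.lt_iff q 1).1 h₁
    simpa using this
  obtain ⟨m, hm⟩ := Int.eq_ofNat_of_zero_le hnum
  rw [hm] at hlt
  refine ⟨Nat.pair m (q.den - m - 1), ?_⟩
  simp only [endpoint, Nat.unpair_pair, RatCode.val]
  have : m + (q.den - m - 1) + 1 = q.den := by omega
  rw [← Nat.cast_add_one, this, Nat.cast_zero, sub_zero]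
  conv_rhs => rw [← Rat.num_div_den q, hm]
  rfl

/-- The `n`-th interval. -/
def interval (n : ℕ) : Set UnitIco := {x | x.1 < ((endpoint n).val : ℝ)}

theorem measurableSet_interval (n : ℕ) : MeasurableSet (interval n) :=
  measurable_subtype_coe measurableSet_Iio

theorem real_interval (n : ℕ) : UnitIco.leb.real (interval n) = (endpoint n).val := by
  have h₀ : (0 : ℝ) ≤ (endpoint n).val := by exact_mod_cast endpoint_nonneg n
  have h₁ : ((endpoint n).val : ℝ) ≤ 1 := by exact_mod_cast (endpoint_lt_one n).le
  have h := UnitIco.real_setOf_Ico le_rfl h₀ h₁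
  rw [sub_zero] at h
  rw [← h]
  congr 1
  ext x
  exact ⟨fun hx => ⟨x.2.1, hx⟩, fun hx => hx.2⟩

theorem isSetRing_range_setEval :
    IsSetRing (Set.range fun t : BTerm => t.setEval interval) where
  empty_mem := ⟨.bot, rfl⟩
  union_mem := by
    rintro _ _ ⟨s, rfl⟩ ⟨t, rfl⟩
    exact ⟨.sup s t, rfl⟩
  sdiff_mem := by
    rintro _ _ ⟨s, rfl⟩ ⟨t, rfl⟩
    exact ⟨.inf s (.compl t), (Set.sdiff_eq _ _).symm⟩

theorem generateFrom_range_setEval : (inferInstance : MeasurableSpace UnitIco) =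
    MeasurableSpace.generateFrom (Set.range fun t : BTerm => t.setEval interval) := by
  apply le_antisymm
  · change MeasurableSpace.comap Subtype.val (inferInstance : MeasurableSpace ℝ) ≤ _
    rw [BorelSpace.measurable_eq (α := ℝ), Real.borel_eq_generateFrom_Iio_rat,
      MeasurableSpace.comap_generateFrom]
    refine MeasurableSpace.generateFrom_le ?_
    rintro _ ⟨_, hs, rfl⟩
    simp only [Set.mem_iUnion, Set.mem_singleton_iff] at hs
    obtain ⟨q, rfl⟩ := hs
    refine MeasurableSpace.measurableSet_generateFrom ?_
    rcases lt_or_ge q 0 with h₀ | h₀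
    · refine ⟨.bot, (Set.eq_empty_of_forall_notMem fun x hx => ?_).symm⟩
      have h : (q : ℝ) < 0 := by exact_mod_cast h₀
      exact absurd (x.2.1.trans_lt hx) h.le.not_gt
    rcases lt_or_ge q 1 with h₁ | h₁
    · obtain ⟨n, rfl⟩ := exists_endpoint_eq h₀ h₁
      exact ⟨.var n, rfl⟩
    · refine ⟨.top, (Set.eq_univ_of_forall fun x => ?_).symm⟩
      have h : (1 : ℝ) ≤ q := by exact_mod_cast h₁
      exact x.2.2.trans_le h
  · refine MeasurableSpace.generateFrom_le ?_
    rintro _ ⟨t, rfl⟩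
    exact BTerm.measurableSet_setEval measurableSet_interval t

theorem dense_generated : Dense (Set.range fun t : BTerm =>
    t.eval fun n => mk (interval n) (measurableSet_interval n)) := by
  rw [Metric.dense_iff]
  intro A ε hε
  induction A using ind with
  | _ s hs =>
  have hd := dense_of_generateFrom_isSetRing (μ := UnitIco.leb) isSetRing_range_setEval
    ⟨{Set.univ}, Set.countable_singleton _,
      Set.singleton_subset_iff.2 ⟨.top, rfl⟩, by simp⟩ generateFrom_range_setEval
  obtain ⟨t, ht, ⟨r, hr⟩⟩ := Metric.dense_iff.1 hd ⟨s, hs⟩ ε hε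
  refine ⟨_, ?_, ⟨r, rfl⟩⟩
  simp only [BTerm.eval_mk]
  have h : mk (r.setEval interval) (BTerm.measurableSet_setEval measurableSet_interval r) =
      SeparationQuotient.mk t := congrArg SeparationQuotient.mk (Subtype.ext hr)
  rw [h]
  exact ht

/-- The presentation of `𝓑([0,1))` by the intervals `[0, q)` with `q` a rational number in
`[0,1)`. -/
noncomputable def standard : Presentation where
  special n := mk (interval n) (measurableSet_interval n)
  dense_generated := dense_generated

/-- A common denominator of the endpoints of the intervals that occur in a term. -/
def commonDen (t : BTerm) : ℕ :=
  t.fold 1 1 (fun n => (endpoint n).2.2 + 1) id (· * ·) (· * ·)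

theorem commonDen_pos (t : BTerm) : 0 < commonDen t := by
  induction t with
  | bot => exact Nat.one_pos
  | top => exact Nat.one_pos
  | var n => exact Nat.succ_pos _
  | compl t ih => exact ih
  | inf s t ihs iht => exact Nat.mul_pos ihs iht
  | sup s t ihs iht => exact Nat.mul_pos ihs iht

theorem computable_commonDen : Computable commonDen := by
  have hv : Computable₂ fun (_ : Unit) n => (endpoint n).2.2 + 1 :=
    Computable.succ.comp (RatCode.primrec_den.to_comp.comp
      (computable_endpoint.comp Computable.snd))
  exact (BTerm.computable_fold 1 1 hv Computable.id Primrec.nat_mul.to_comp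
    Primrec.nat_mul.to_comp).comp (Computable.const ()) Computable.id

/-- Whether `p.1 / p.2` lies in the `n`-th interval. -/
def gridMem (p : ℕ × ℕ) (n : ℕ) : Bool :=
  decide (p.1 * ((endpoint n).2.2 + 1) < (endpoint n).1 * p.2)

theorem computable_gridMem : Computable₂ gridMem := by
  have h₁ : Primrec fun n : ℕ => n.unpair.1 := Primrec.fst.comp Primrec.unpair
  have h₂ : Primrec fun n : ℕ => n.unpair.2 := Primrec.snd.comp Primrec.unpair
  exact (Primrec.nat_lt.comp
    (Primrec.nat_mul.comp (Primrec.fst.comp Primrec.fst)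
      (Primrec.succ.comp (Primrec.nat_add.comp (h₁.comp Primrec.snd) (h₂.comp Primrec.snd))))
    (Primrec.nat_mul.comp (h₁.comp Primrec.snd)
      (Primrec.snd.comp Primrec.fst))).decide.to_comp

/-- A set named by a term whose endpoints have common denominator `M` is a union of intervals
`[i / M, (i + 1) / M)`. -/
theorem mem_setEval_iff_of_dvd {t : BTerm} {i M : ℕ} (hM : 0 < M) (ht : commonDen t ∣ M)
    {x : UnitIco} (hx : x.1 ∈ Set.Ico ((i : ℝ) / M) (((i + 1 : ℕ) : ℝ) / M)) :
    x ∈ t.setEval interval ↔ t.beval (gridMem (i, M)) = true := by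
  induction t with
  | bot => simp [BTerm.setEval, BTerm.beval, BTerm.fold]
  | top => simp [BTerm.setEval, BTerm.beval, BTerm.fold]
  | var n =>
    change x.1 < ((endpoint n).val : ℝ) ↔ gridMem (i, M) n = true
    obtain ⟨e, rfl⟩ := ht
    change 0 < ((endpoint n).2.2 + 1) * e at hM
    have he : 0 < e := Nat.pos_of_mul_pos_left hM
    have hval : ((endpoint n).val : ℝ) =
        (((endpoint n).1 * e : ℕ) : ℝ) / ((((endpoint n).2.2 + 1) * e : ℕ) : ℝ) := by
      simp only [RatCode.val, endpoint]
      have : (e : ℝ) ≠ 0 := by positivity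
      push_cast
      rw [sub_zero, mul_div_mul_right _ _ this]
    have hM' : (0 : ℝ) < ((((endpoint n).2.2 + 1) * e : ℕ) : ℝ) := by exact_mod_cast hM
    change x.1 ∈ Set.Ico ((i : ℝ) / ((((endpoint n).2.2 + 1) * e : ℕ) : ℝ))
      (((i + 1 : ℕ) : ℝ) / ((((endpoint n).2.2 + 1) * e : ℕ) : ℝ)) at hx
    have hg : gridMem (i, commonDen (.var n) * e) n = true ↔ i < (endpoint n).1 * e := by
      change decide (i * ((endpoint n).2.2 + 1) <
        (endpoint n).1 * (((endpoint n).2.2 + 1) * e)) = true ↔ _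
      rw [decide_eq_true_eq, mul_comm _ e, ← mul_assoc]
      exact Nat.mul_lt_mul_right (Nat.succ_pos _)
    rw [hval, hg]
    constructor
    · intro h
      have := (div_lt_div_iff_of_pos_right hM').1 (hx.1.trans_lt h)
      exact_mod_cast this
    · intro h
      refine hx.2.trans_le ?_
      rw [div_le_div_iff_of_pos_right hM']
      exact_mod_cast h
  | compl t ih =>
    change ¬ (x ∈ t.setEval interval) ↔ (!t.beval _) = true
    simp [ih ht]
  | inf s t ihs iht =>
    change x ∈ s.setEval interval ∧ x ∈ t.setEval interval ↔ (s.beval _ && t.beval _) = true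
    simp [ihs ((Nat.dvd_mul_right _ _).trans ht), iht ((Nat.dvd_mul_left _ _).trans ht)]
  | sup s t ihs iht =>
    change x ∈ s.setEval interval ∨ x ∈ t.setEval interval ↔ (s.beval _ || t.beval _) = true
    simp [ihs ((Nat.dvd_mul_right _ _).trans ht), iht ((Nat.dvd_mul_left _ _).trans ht)]

/-- The number of `i < N` such that `i / M` belongs to the set named by `t`. -/
def gridCount (t : BTerm) (M N : ℕ) : ℕ :=
  Nat.rec 0 (fun i c => bif t.beval (gridMem (i, M)) then c + 1 else c) N

theorem computable_gridCount :
    Computable fun p : BTerm × ℕ × ℕ => gridCount p.1 p.2.1 p.2.2 := by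
  have hb : Computable₂ fun (p : BTerm × ℕ × ℕ) (q : ℕ × ℕ) =>
      p.1.beval (gridMem (q.1, p.2.1)) :=
    (BTerm.computable_beval computable_gridMem).comp
      ((Computable.fst.comp Computable.snd).pair
        (Computable.fst.comp (Computable.snd.comp Computable.fst)))
      (Computable.fst.comp Computable.fst)
  have hc : Computable₂ fun (_ : BTerm × ℕ × ℕ) (q : ℕ × ℕ) => q.2 :=
    Computable.snd.comp Computable.snd
  have hstep : Computable₂ fun (p : BTerm × ℕ × ℕ) (q : ℕ × ℕ) =>
      bif p.1.beval (gridMem (q.1, p.2.1)) then q.2 + 1 else q.2 :=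
    Computable.cond hb (Computable.succ.comp hc) hc
  have hN : Computable fun p : BTerm × ℕ × ℕ => p.2.2 := Computable.snd.comp Computable.snd
  exact (Computable.nat_rec hN (Computable.const 0) hstep).of_eq fun _ => rfl

theorem real_setEval_inter (t : BTerm) {M : ℕ} (hM : 0 < M) (ht : commonDen t ∣ M) {N : ℕ}
    (hN : N ≤ M) :
    UnitIco.leb.real (t.setEval interval ∩ {x | x.1 ∈ Set.Ico 0 ((N : ℝ) / M)}) =
      (gridCount t M N : ℝ) / M := by
  have hM' : (0 : ℝ) < M := by exact_mod_cast hM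
  induction N with
  | zero => simp [gridCount]
  | succ N ih =>
    have hle : (N : ℝ) / M ≤ ((N + 1 : ℕ) : ℝ) / M := by
      rw [div_le_div_iff_of_pos_right hM']; push_cast; linarith
    have h₀ : (0 : ℝ) ≤ (N : ℝ) / M := by positivity
    have h₁ : ((N + 1 : ℕ) : ℝ) / M ≤ 1 := by
      rw [div_le_one hM']; exact_mod_cast hN
    have hJ : UnitIco.leb.real (t.setEval interval ∩
        {x | x.1 ∈ Set.Ico ((N : ℝ) / M) (((N + 1 : ℕ) : ℝ) / M)}) =
        bif t.beval (gridMem (N, M)) then 1 / (M : ℝ) else 0 := by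
      cases hb : t.beval (gridMem (N, M)) with
      | true =>
        have hsub : {x : UnitIco | x.1 ∈ Set.Ico ((N : ℝ) / M) (((N + 1 : ℕ) : ℝ) / M)} ⊆
            t.setEval interval := fun x hx => (mem_setEval_iff_of_dvd hM ht hx).2 hb
        rw [Set.inter_eq_self_of_subset_right hsub, UnitIco.real_setOf_Ico h₀ hle h₁]
        push_cast
        simp only [cond_true]
        ring
      | false =>
        rw [Set.eq_empty_of_forall_notMem (s := t.setEval interval ∩ _) fun x hx => by
          have := (mem_setEval_iff_of_dvd hM ht hx.2).1 hx.1
          simp [hb] at this]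
        simp
    have hunion : t.setEval interval ∩ {x | x.1 ∈ Set.Ico 0 (((N + 1 : ℕ) : ℝ) / M)} =
        (t.setEval interval ∩ {x | x.1 ∈ Set.Ico 0 ((N : ℝ) / M)}) ∪
        (t.setEval interval ∩ {x | x.1 ∈ Set.Ico ((N : ℝ) / M) (((N + 1 : ℕ) : ℝ) / M)}) := by
      rw [← Set.inter_union_distrib_left]
      congr 1
      ext x
      rw [Set.mem_union, Set.mem_ofPred_eq, ← Set.Ico_union_Ico_eq_Ico h₀ hle]
      rfl
    rw [hunion, measureReal_union, ih (Nat.le_of_succ_le hN), hJ]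
    · change _ = ((bif t.beval (gridMem (N, M)) then gridCount t M N + 1
        else gridCount t M N : ℕ) : ℝ) / M
      cases t.beval (gridMem (N, M)) with
      | true => simp only [cond_true]; push_cast; ring
      | false => simp
    · rw [Set.disjoint_left]
      rintro x ⟨-, hx⟩ ⟨-, hx'⟩
      exact absurd hx.2 hx'.1.not_gt
    · exact (BTerm.measurableSet_setEval measurableSet_interval t).inter
        (measurable_subtype_coe measurableSet_Ico)

theorem meas_gen (t : BTerm) : (standard.gen t).meas =
    (gridCount t (commonDen t) (commonDen t) : ℝ) / commonDen t := by
  have h := real_setEval_inter t (commonDen_pos t) dvd_rfl le_rfl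
  have hM : ((commonDen t : ℕ) : ℝ) ≠ 0 := by exact_mod_cast (commonDen_pos t).ne'
  rw [div_self hM] at h
  rw [← h]
  change (t.eval fun n => mk (interval n) (measurableSet_interval n)).meas = _
  rw [BTerm.eval_mk, meas_mk]
  congr 1
  exact (Set.inter_eq_self_of_subset_left fun x _ => x.2).symm

/-- The algorithm that computes the exact measure of a generated point. -/
def measAlg (t : BTerm) : RatCode :=
  (gridCount t (commonDen t) (commonDen t), 0, (commonDen t).pred)

theorem computable_measAlg : Computable measAlg := by
  have hp : Computable fun t : BTerm => (t, commonDen t, commonDen t) :=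
    Computable.id.pair (computable_commonDen.pair computable_commonDen)
  have hc : Computable fun t : BTerm => gridCount t (commonDen t) (commonDen t) :=
    (computable_gridCount.comp hp).of_eq fun _ => rfl
  have hd : Computable fun t : BTerm => (commonDen t).pred :=
    Computable.pred.comp computable_commonDen
  exact (hc.pair ((Computable.const 0).pair hd)).of_eq fun _ => rfl

theorem val_measAlg (t : BTerm) : ((measAlg t).val : ℝ) = (standard.gen t).meas := by
  rw [meas_gen]
  simp only [measAlg, RatCode.val]
  rw [← Nat.cast_add_one (commonDen t).pred, ← Nat.succ_eq_add_one,
    Nat.succ_pred_eq_of_pos (commonDen_pos t)]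
  push_cast
  rw [sub_zero]

theorem isComputable_standard : standard.IsComputable := by
  refine ⟨fun t _ => measAlg t, computable_measAlg.comp Computable.fst, fun t ε hε => ?_⟩
  rw [val_measAlg, sub_self, abs_zero]
  exact_mod_cast hε

end StandardPresentation

/-! ### The distribution function of an atomless law -/

namespace ProbabilityTheory

open Filter Topology

variable (ν : Measure ℝ)

/-- The distribution function, as a map to `[0,1)`; the value `1`, which is attained on a null set
only, is replaced by `0`. -/
noncomputable def cdfIco (y : ℝ) : UnitIco :=
  ⟨Int.fract (cdf ν y), Int.fract_nonneg _, Int.fract_lt_one _⟩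

theorem measurable_cdfIco : Measurable (cdfIco ν) :=
  ((monotone_cdf ν).measurable.fract).subtype_mk

theorem cdfIco_val {y : ℝ} (h : cdf ν y ∈ Set.Ico (0 : ℝ) 1) : (cdfIco ν y).1 = cdf ν y :=
  Int.fract_eq_self.2 h

variable [IsProbabilityMeasure ν] [NullSingletonClass ν]

theorem continuous_cdf : Continuous (cdf ν) := by
  refine continuous_iff_continuousAt.2 fun x => ?_
  rw [(cdf ν).mono.continuousAt_iff_leftLim_eq_rightLim, StieltjesFunction.rightLim_eq]
  have h := (cdf ν).measure_singleton x
  rw [measure_cdf, measure_singleton] at h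
  have h' := ENNReal.ofReal_eq_zero.1 h.symm
  exact le_antisymm ((cdf ν).mono.leftLim_le le_rfl) (sub_nonpos.1 h')

theorem real_cdf_le {t : ℝ} (h₀ : 0 ≤ t) (h₁ : t < 1) : ν.real {x | cdf ν x ≤ t} = t := by
  apply le_antisymm
  · rcases Set.eq_empty_or_nonempty {x | cdf ν x ≤ t} with h | hne
    · rw [h, measureReal_empty]; exact h₀
    · obtain ⟨b, hb⟩ := ((tendsto_cdf_atTop ν).eventually_const_lt h₁).exists
      have hbdd : BddAbove {x | cdf ν x ≤ t} :=
        ⟨b, fun x hx => le_of_not_gt fun hlt => (hb.trans_le (monotone_cdf ν hlt.le)).not_ge hx⟩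
      have hmem := (isClosed_le (continuous_cdf ν) continuous_const).csSup_mem hne hbdd
      have hmem' : cdf ν (sSup {x | cdf ν x ≤ t}) ≤ t := hmem
      rw [cdf_eq_real] at hmem'
      exact (measureReal_mono fun x hx => le_csSup hbdd hx).trans hmem'
  · rcases h₀.eq_or_lt with rfl | h₀
    · exact measureReal_nonneg
    · obtain ⟨y, rfl⟩ := mem_range_of_exists_le_of_exists_ge (continuous_cdf ν)
        (((tendsto_cdf_atBot ν).eventually_lt_const h₀).exists.imp fun _ h => h.le)
        (((tendsto_cdf_atTop ν).eventually_const_lt h₁).exists.imp fun _ h => h.le)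
      conv_lhs => rw [cdf_eq_real]
      exact measureReal_mono fun x hx => monotone_cdf ν hx

/-- The probability integral transform: the distribution function of an atomless law is uniformly
distributed. -/
theorem map_cdf : ν.map (cdf ν) = volume.restrict (Set.Ico 0 1) := by
  have hm : Measurable (cdf ν) := (monotone_cdf ν).measurable
  have : IsFiniteMeasure (ν.map (cdf ν)) := Measure.isFiniteMeasure_map _ _
  refine Measure.ext_of_Iic _ _ fun t => ?_
  rw [Measure.map_apply hm measurableSet_Iic, Measure.restrict_apply measurableSet_Iic]
  rcases lt_or_ge t 0 with h₀ | h₀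
  · rw [show (cdf ν) ⁻¹' Set.Iic t = ∅ from Set.eq_empty_of_forall_notMem fun x hx =>
      (cdf_nonneg ν x).not_gt ((show cdf ν x ≤ t from hx).trans_lt h₀),
      show Set.Iic t ∩ Set.Ico (0 : ℝ) 1 = ∅ from Set.eq_empty_of_forall_notMem fun x hx =>
      hx.2.1.not_gt (lt_of_le_of_lt hx.1 h₀)]
    simp
  rcases lt_or_ge t 1 with h₁ | h₁
  · rw [show Set.Iic t ∩ Set.Ico (0 : ℝ) 1 = Set.Icc 0 t by ext x; simp; grind, Real.volume_Icc,
      sub_zero, ← real_cdf_le ν h₀ h₁, ofReal_measureReal, real_cdf_le ν h₀ h₁]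
    rfl
  · rw [show (cdf ν) ⁻¹' Set.Iic t = Set.univ from Set.eq_univ_of_forall fun x =>
      (cdf_le_one ν x).trans h₁, show Set.Iic t ∩ Set.Ico (0 : ℝ) 1 = Set.Ico 0 1 from
      Set.inter_eq_self_of_subset_right fun x hx => hx.2.le.trans h₁]
    simp

theorem ae_cdf_mem_Ico : ∀ᵐ y ∂ν, cdf ν y ∈ Set.Ico (0 : ℝ) 1 := by
  have hm : Measurable (cdf ν) := (monotone_cdf ν).measurable
  refine (ae_map_iff hm.aemeasurable measurableSet_Ico).1 ?_
  rw [map_cdf]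
  exact ae_restrict_mem measurableSet_Ico

theorem map_cdfIco : ν.map (cdfIco ν) = UnitIco.leb := by
  have hemb : MeasurableEmbedding (Subtype.val : UnitIco → ℝ) :=
    MeasurableEmbedding.subtype_coe measurableSet_Ico
  have h : (ν.map (cdfIco ν)).map Subtype.val = volume.restrict (Set.Ico 0 1) := by
    rw [Measure.map_map measurable_subtype_coe (measurable_cdfIco ν), ← map_cdf ν]
    exact Measure.map_congr ((ae_cdf_mem_Ico ν).mono fun y hy => cdfIco_val ν hy)
  rw [← hemb.comap_map (ν.map (cdfIco ν)), h, ← map_comap_subtype_coe measurableSet_Ico,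
    hemb.comap_map]

/-- The distribution function of an atomless law is injective off a null set: two distinct points
with the same value have a rational point with that value between them, and each value is attained
on a null set only. The points where the value is `1` are discarded as well. -/
theorem exists_injOn_cdfIco :
    ∃ N : Set ℝ, MeasurableSet N ∧ ν N = 0 ∧ Set.InjOn (cdfIco ν) Nᶜ := by
  have hm : Measurable (cdf ν) := (monotone_cdf ν).measurable
  have hI : MeasurableSet {y | cdf ν y ∈ Set.Ico (0 : ℝ) 1} := hm measurableSet_Ico
  refine ⟨{y | cdf ν y ∈ Set.Ico (0 : ℝ) 1}ᶜ ∪ ⋃ r : ℚ, cdf ν ⁻¹' {cdf ν r},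
    hI.compl.union (MeasurableSet.iUnion fun r => hm (measurableSet_singleton _)),
    measure_union_null (ae_cdf_mem_Ico ν) (measure_iUnion_null fun r => ?_), ?_⟩
  · rw [← Measure.map_apply hm (measurableSet_singleton _), map_cdf, measure_singleton]
  · have key : ∀ x y : ℝ, x ∉ ⋃ r : ℚ, cdf ν ⁻¹' {cdf ν r} → cdf ν x = cdf ν y → ¬ x < y := by
      intro x y hx h hlt
      obtain ⟨r, hxr, hry⟩ := exists_rat_btwn hlt
      refine hx (Set.mem_iUnion.2 ⟨r, ?_⟩)
      exact le_antisymm (monotone_cdf ν hxr.le) (h ▸ monotone_cdf ν hry.le)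
    intro x hx y hy h
    rw [Set.mem_compl_iff, Set.mem_union, not_or, Set.notMem_compl_iff] at hx hy
    have h' : cdf ν x = cdf ν y := by
      rw [← cdfIco_val ν hx.1, ← cdfIco_val ν hy.1, h]
    exact le_antisymm (not_lt.1 (key y x hy.2 h'.symm)) (not_lt.1 (key x y hx.2 h'))

end ProbabilityTheory

/-! ### Automorphisms induced by measure-preserving maps -/

namespace ProbAlg

/-- The preimage under a measure-preserving map, on classes of Borel sets. -/
noncomputable def preimage (V : UnitIco → UnitIco)
    (hV : MeasurePreserving V UnitIco.leb UnitIco.leb) :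
    ProbAlg → ProbAlg :=
  SeparationQuotient.lift (fun s : BorelIco => mk (V ⁻¹' (s : Set UnitIco)) (hV.measurable s.2))
    fun s t h => mk_eq_mk (hV.quasiMeasurePreserving.preimage_ae_eq ((inseparable_iff_ae s t).1 h))

theorem preimage_mk {V : UnitIco → UnitIco} (hV : MeasurePreserving V UnitIco.leb UnitIco.leb)
    {s : Set UnitIco} (hs : MeasurableSet s) :
    preimage V hV (mk s hs) = mk (V ⁻¹' s) (hV.measurable hs) := rfl

theorem meas_preimage {V : UnitIco → UnitIco} (hV : MeasurePreserving V UnitIco.leb UnitIco.leb)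
    (A : ProbAlg) : (preimage V hV A).meas = A.meas := by
  induction A using ind with
  | _ s hs =>
  rw [preimage_mk, meas_mk, meas_mk]
  exact hV.measureReal_preimage hs.nullMeasurableSet

theorem preimage_compl {V : UnitIco → UnitIco} (hV : MeasurePreserving V UnitIco.leb UnitIco.leb)
    (A : ProbAlg) : preimage V hV Aᶜ = (preimage V hV A)ᶜ := by
  induction A using ind with
  | _ s hs => rfl

theorem preimage_inf {V : UnitIco → UnitIco} (hV : MeasurePreserving V UnitIco.leb UnitIco.leb)
    (A B : ProbAlg) : preimage V hV (A ⊓ B) = preimage V hV A ⊓ preimage V hV B := by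
  induction A using ind with
  | _ s hs =>
  induction B using ind with
  | _ t ht => rfl

theorem preimage_sup {V : UnitIco → UnitIco} (hV : MeasurePreserving V UnitIco.leb UnitIco.leb)
    (A B : ProbAlg) : preimage V hV (A ⊔ B) = preimage V hV A ⊔ preimage V hV B := by
  induction A using ind with
  | _ s hs =>
  induction B using ind with
  | _ t ht => rfl

theorem preimage_injective {V : UnitIco → UnitIco}
    (hV : MeasurePreserving V UnitIco.leb UnitIco.leb) : Function.Injective (preimage V hV) := by
  intro A B h
  rw [← dist_eq_zero, dist_eq_meas] at h ⊢
  rwa [← preimage_compl, ← preimage_compl, ← preimage_inf, ← preimage_inf, ← preimage_sup,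
    meas_preimage] at h

/-- A measure-preserving map induces an automorphism if every Borel set is a preimage modulo null
sets. -/
noncomputable def Iso.ofMeasurePreserving (V : UnitIco → UnitIco)
    (hV : MeasurePreserving V UnitIco.leb UnitIco.leb)
    (hsurj : ∀ s : Set UnitIco, MeasurableSet s →
      ∃ t, MeasurableSet t ∧ V ⁻¹' t =ᵐ[UnitIco.leb] s) : Iso where
  toEquiv := Equiv.ofBijective (preimage V hV) ⟨preimage_injective hV, fun A => by
    induction A using ind with
    | _ s hs =>
    obtain ⟨t, ht, h⟩ := hsurj s hs
    exact ⟨ProbAlg.mk t ht, mk_eq_mk h⟩⟩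
  map_bot' := rfl
  map_top' := rfl
  map_compl' := preimage_compl hV
  map_inf' := preimage_inf hV
  map_sup' := preimage_sup hV
  map_meas' := meas_preimage hV

end ProbAlg

/-! ### Functions generating the Borel sets modulo null sets -/

section Generating

open ProbabilityTheory

variable {f : UnitIco → ℝ}

/-- If every Borel set is modulo null sets a preimage under `f`, then the law of `f` is atomless:
otherwise, a level set of positive measure could not be split into parts of smaller positive
measure. -/
theorem nullSingletonClass_map_of_generating (hf : Measurable f)
    (hgen : ∀ s : Set UnitIco, MeasurableSet s →
      ∃ B : Set ℝ, MeasurableSet B ∧ f ⁻¹' B =ᵐ[UnitIco.leb] s) :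
    NullSingletonClass (UnitIco.leb.map f) := by
  refine ⟨fun y => ?_⟩
  rw [Measure.map_apply hf (measurableSet_singleton y)]
  by_contra hne
  obtain ⟨n, hn⟩ := ENNReal.exists_inv_nat_lt hne
  have hn₀ : n ≠ 0 := by
    rintro rfl
    simp at hn
  have hn' : (0 : ℝ) < n := by exact_mod_cast Nat.pos_of_ne_zero hn₀
  let E : ℤ → Set UnitIco := fun i => {x | x.1 ∈ Set.Ico ((i : ℝ) / n) ((i + 1 : ℝ) / n)}
  have hEm : ∀ i, MeasurableSet (E i) := fun i => measurable_subtype_coe measurableSet_Ico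
  have hE : ∀ i, UnitIco.leb (E i) ≤ (n : ENNReal)⁻¹ := by
    intro i
    rw [comap_subtype_coe_apply measurableSet_Ico]
    refine (measure_mono (Set.image_subset_iff.2 fun x hx => hx) :
      _ ≤ volume (Set.Ico ((i : ℝ) / n) ((i + 1 : ℝ) / n))).trans ?_
    rw [Real.volume_Ico, ← sub_div, add_sub_cancel_left, one_div, ENNReal.ofReal_inv_of_pos hn',
      ENNReal.ofReal_natCast]
  refine hne (measure_mono_null (t := ⋃ i, f ⁻¹' {y} ∩ E i) (fun x hx => ?_)
    (measure_iUnion_null fun i => ?_))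
  · refine Set.mem_iUnion.2 ⟨⌊x.1 * n⌋, hx, ?_, ?_⟩
    · rw [div_le_iff₀ hn']; exact Int.floor_le _
    · rw [lt_div_iff₀ hn']; exact Int.lt_floor_add_one _
  · obtain ⟨B, -, hB⟩ := hgen (E i) (hEm i)
    rw [measure_congr ((Filter.EventuallyEq.refl _ (f ⁻¹' {y})).inter hB.symm)]
    by_cases hy : y ∈ B
    · exfalso
      have hsub : f ⁻¹' {y} ⊆ f ⁻¹' B := fun x hx => by
        rw [Set.mem_preimage, Set.mem_singleton_iff.1 hx]; exact hy
      exact (hn.trans_le ((measure_mono hsub).trans_eq (measure_congr hB))).not_ge (hE i)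
    · rw [Set.eq_empty_of_forall_notMem (s := f ⁻¹' {y} ∩ f ⁻¹' B) fun x hx => hy ?_,
        measure_empty]
      exact Set.mem_singleton_iff.1 hx.1 ▸ hx.2

variable [NullSingletonClass (UnitIco.leb.map f)]

theorem measurePreserving_cdfIco_comp (hf : Measurable f)
    [IsProbabilityMeasure (UnitIco.leb.map f)] :
    MeasurePreserving (cdfIco (UnitIco.leb.map f) ∘ f) UnitIco.leb UnitIco.leb :=
  ⟨(measurable_cdfIco _).comp hf, by
    rw [← Measure.map_map (measurable_cdfIco _) hf, map_cdfIco]⟩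

/-- Images of Borel sets under injective Borel maps are Borel, so that sets that are preimages
under `f` are preimages under the distribution function of `f`, modulo null sets. -/
theorem exists_preimage_cdfIco_comp_ae_eq (hf : Measurable f)
    [IsProbabilityMeasure (UnitIco.leb.map f)]
    (hgen : ∀ s : Set UnitIco, MeasurableSet s →
      ∃ B : Set ℝ, MeasurableSet B ∧ f ⁻¹' B =ᵐ[UnitIco.leb] s)
    (s : Set UnitIco) (hs : MeasurableSet s) : ∃ t, MeasurableSet t ∧
      (cdfIco (UnitIco.leb.map f) ∘ f) ⁻¹' t =ᵐ[UnitIco.leb] s := by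
  obtain ⟨B, hBm, hB⟩ := hgen s hs
  obtain ⟨N, hNm, hN, hinj⟩ := exists_injOn_cdfIco (UnitIco.leb.map f)
  refine ⟨cdfIco (UnitIco.leb.map f) '' (B \ N), (hBm.diff hNm).image_of_measurable_injOn
    (measurable_cdfIco _) (hinj.mono fun y hy => hy.2), Filter.EventuallyEq.trans ?_ hB⟩
  rw [Measure.map_apply hf hNm] at hN
  have hN' : ∀ᵐ x ∂UnitIco.leb, f x ∉ N := by
    rw [ae_iff]; simpa using! hN
  filter_upwards [hN'] with x hx
  refine propext ⟨?_, fun h => ⟨f x, ⟨h, hx⟩, rfl⟩⟩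
  rintro ⟨y, hy, hyx⟩
  have h : y = f x := hinj hy.2 hx hyx
  exact Set.mem_preimage.2 (h ▸ hy.1)

end Generating

/-! ### The lexicographic order on binary sequences -/

namespace Cardinal

theorem continuous_cantorFunction {c : ℝ} (h₀ : 0 ≤ c) (h₁ : c < 1) :
    Continuous (cantorFunction c) := by
  refine continuous_tsum (u := fun n => c ^ n) (fun n => ?_)
    (summable_geometric_of_lt_one h₀ h₁) fun n u => ?_
  · exact (continuous_of_discreteTopology (f := fun b : Bool => cond b (c ^ n) 0)).comp
      (continuous_apply n)
  · rw [Real.norm_of_nonneg (cantorFunctionAux_nonneg h₀)]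
    cases h : u n with
    | true => rw [cantorFunctionAux_true h]
    | false => rw [cantorFunctionAux_false h]; positivity

theorem cantorFunction_nonneg (u : ℕ → Bool) : 0 ≤ cantorFunction (1 / 3) u :=
  tsum_nonneg fun _ => cantorFunctionAux_nonneg (by norm_num)

theorem cantorFunction_third_le (u : ℕ → Bool) : cantorFunction (1 / 3) u ≤ 3 / 2 := by
  refine (cantorFunction_le (g := fun _ => true) (by norm_num) (by norm_num)
    fun _ _ => rfl).trans ?_
  have h : cantorFunction (1 / 3) (fun _ => true) = ∑' n : ℕ, (1 / 3 : ℝ) ^ n :=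
    tsum_congr fun n => cantorFunctionAux_true rfl
  rw [h, tsum_geometric_of_lt_one (by norm_num) (by norm_num)]
  norm_num

/-- The lexicographic comparison of two binary sequences by their heads and tails; the base `3` makes
the contribution of the tail too small to outweigh the head. -/
theorem cantorFunction_lt_iff (u v : ℕ → Bool) :
    cantorFunction (1 / 3) u < cantorFunction (1 / 3) v ↔
      bif v 0 then u 0 = false ∨
        cantorFunction (1 / 3) (fun n => u (n + 1)) < cantorFunction (1 / 3) (fun n => v (n + 1))
      else u 0 = false ∧
        cantorFunction (1 / 3) (fun n => u (n + 1)) <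
          cantorFunction (1 / 3) (fun n => v (n + 1)) := by
  have h₁ := cantorFunction_nonneg fun n => u (n + 1)
  have h₂ := cantorFunction_nonneg fun n => v (n + 1)
  have h₃ := cantorFunction_third_le fun n => u (n + 1)
  have h₄ := cantorFunction_third_le fun n => v (n + 1)
  rw [cantorFunction_succ u (by norm_num) (by norm_num),
    cantorFunction_succ v (by norm_num) (by norm_num)]
  cases u 0 <;> cases v 0 <;> simp <;> linarith

end Cardinal

open Cardinal

/-- A finite binary sequence, continued by zeros. -/
def padFalse (σ : List Bool) (n : ℕ) : Bool := σ.getD n false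

theorem tendsto_cantorFunction_padFalse (u : ℕ → Bool) :
    Filter.Tendsto (fun n => cantorFunction (1 / 3) (padFalse ((List.range n).map u))) Filter.atTop
      (nhds (cantorFunction (1 / 3) u)) := by
  refine ((continuous_cantorFunction (by norm_num) (by norm_num)).tendsto u).comp
    (tendsto_pi_nhds.2 fun k => ?_)
  refine tendsto_const_nhds.congr' ?_
  filter_upwards [Filter.eventually_gt_atTop k] with n hn
  simp [padFalse, hn]

namespace BTerm

/-- The term for the set of points whose sequence of memberships in the sets `xᵢ, xᵢ₊₁, …` is
lexicographically below `σ` continued by zeros. -/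
def lexLower : ℕ → List Bool → BTerm
  | _, [] => bot
  | i, b :: σ => bif b then sup (compl (var i)) (lexLower (i + 1) σ)
      else inf (compl (var i)) (lexLower (i + 1) σ)

theorem mem_setEval_lexLower {X : Type*} {A : ℕ → Set X} {x : X} {u : ℕ → Bool}
    (hu : ∀ n, u n = true ↔ x ∈ A n) (i : ℕ) (σ : List Bool) :
    x ∈ (lexLower i σ).setEval A ↔
      cantorFunction (1 / 3) (fun n => u (i + n)) < cantorFunction (1 / 3) (padFalse σ) := by
  induction σ generalizing i with
  | nil =>
    have h : cantorFunction (1 / 3) (padFalse []) = 0 := by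
      refine (tsum_congr fun n => ?_).trans tsum_zero
      exact cantorFunctionAux_false rfl
    rw [h]
    exact iff_of_false id (cantorFunction_nonneg _).not_gt
  | cons b σ ih =>
    have ht : (fun n => padFalse (b :: σ) (n + 1)) = padFalse σ := rfl
    have hs : (fun n => u (i + (n + 1))) = fun n => u (i + 1 + n) := by
      funext n; congr 1; omega
    have h0 : u (i + 0) = false ↔ x ∉ A i := by
      rw [← hu, Bool.not_eq_true, add_zero]
    rw [cantorFunction_lt_iff, ht, hs, h0, ← ih]
    cases b <;> rfl

theorem primrec_lexLower : Primrec (lexLower 0) := by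
  let g : List Bool → Bool × List Bool × BTerm → BTerm := fun σ p =>
    bif p.1 then sup (compl (var (σ.length - (p.2.1.length + 1)))) p.2.2
      else inf (compl (var (σ.length - (p.2.1.length + 1)))) p.2.2
  have hidx : Primrec fun p : List Bool × Bool × List Bool × BTerm =>
      compl (var (p.1.length - (p.2.2.1.length + 1))) :=
    primrec_compl.comp <| primrec_var.comp <| Primrec.nat_sub.comp
      (Primrec.list_length.comp Primrec.fst)
      (Primrec.succ.comp (Primrec.list_length.comp
        (Primrec.fst.comp (Primrec.snd.comp Primrec.snd))))
  have hrec : Primrec fun p : List Bool × Bool × List Bool × BTerm => p.2.2.2 :=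
    Primrec.snd.comp (Primrec.snd.comp Primrec.snd)
  have hg : Primrec₂ g :=
    Primrec.cond (Primrec.fst.comp Primrec.snd) (primrec_sup.comp hidx hrec)
      (primrec_inf.comp hidx hrec)
  refine (Primrec.list_rec Primrec.id (Primrec.const bot) hg).of_eq fun σ => ?_
  -- In the recursion along `σ`, the index of the current digit is determined by the length of the
  -- remaining list.
  have key : ∀ (τ : List Bool) (i : ℕ), i + τ.length = σ.length →
      (List.recOn τ bot fun b l IH => g σ (b, l, IH) : BTerm) = lexLower i τ := by
    intro τ
    induction τ with
    | nil => intro i _; rfl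
    | cons b τ ih =>
      intro i hi
      rw [List.length_cons] at hi
      have h₁ := ih (i + 1) (by omega)
      have h₂ : σ.length - (τ.length + 1) = i := by omega
      change g σ (b, τ, List.recOn τ bot fun b l IH => g σ (b, l, IH)) = _
      rw [h₁]
      simp only [g, h₂, lexLower]
  exact key σ 0 (Nat.zero_add _)

end BTerm

/-! ### The real-valued function whose ternary digits are a sequence of sets -/

/-- The real number whose ternary digits, starting with the unit digit, are the truth values, `0` or
`1`, of `x ∈ A n`. -/
noncomputable def digitFunction {X : Type*} (A : ℕ → Set X) (x : X) : ℝ :=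
  open Classical in cantorFunction (1 / 3) fun n => decide (x ∈ A n)

section digitFunction

variable {X : Type*} [MeasurableSpace X] {A : ℕ → Set X}

theorem measurable_digitFunction (hA : ∀ n, MeasurableSet (A n)) :
    Measurable (digitFunction A) := by
  classical
  refine (continuous_cantorFunction (by norm_num) (by norm_num)).measurable.comp
    (measurable_pi_lambda _ fun n => ?_)
  exact measurable_to_bool (by simpa [Set.preimage] using hA n)

/-- The sets `A n` are preimages of Borel sets under `digitFunction A`. -/
theorem exists_preimage_digitFunction {X : Type*} (A : ℕ → Set X) :
    ∃ K : ℕ → Set ℝ, (∀ n, MeasurableSet (K n)) ∧ ∀ n, digitFunction A ⁻¹' K n = A n := by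
  have hc : Measurable (cantorFunction (1 / 3)) :=
    (continuous_cantorFunction (by norm_num) (by norm_num)).measurable
  have hinj : Function.Injective (cantorFunction (1 / 3)) :=
    cantorFunction_injective (by norm_num) (by norm_num)
  refine ⟨fun n => cantorFunction (1 / 3) '' {u | u n = true}, fun n => ?_, fun n => ?_⟩
  · exact (measurable_pi_apply n (measurableSet_singleton true)).image_of_measurable_injOn hc
      hinj.injOn
  · ext x
    classical
    rw [Set.mem_preimage, digitFunction, hinj.mem_set_image]
    simp

theorem BTerm.preimage_setEval {X Y : Type*} (f : X → Y) (K : ℕ → Set Y) (t : BTerm) :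
    f ⁻¹' t.setEval K = t.setEval fun n => f ⁻¹' K n := by
  induction t with
  | bot => rfl
  | top => rfl
  | var n => rfl
  | compl t ih => exact congrArg (·ᶜ) ih
  | inf s t ihs iht => exact congrArg₂ (· ∩ ·) ihs iht
  | sup s t ihs iht => exact congrArg₂ (· ∪ ·) ihs iht

end digitFunction

/-- A set that is approximated by preimages of Borel sets under `f` is such a preimage modulo null
sets, namely that of the upper limit of a fast sequence of approximations. -/
theorem exists_preimage_ae_eq_of_approx {X : Type*} [MeasurableSpace X] {μ : Measure X}
    [IsFiniteMeasure μ] {f : X → ℝ} {s : Set X}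
    (h : ∀ ε > 0, ∃ B : Set ℝ, MeasurableSet B ∧ μ.real (s ∆ (f ⁻¹' B)) < ε) :
    ∃ B : Set ℝ, MeasurableSet B ∧ f ⁻¹' B =ᵐ[μ] s := by
  choose B hBm hB using fun n : ℕ => h ((1 / 2) ^ n) (by positivity)
  refine ⟨Filter.limsup B Filter.atTop, MeasurableSet.measurableSet_limsup hBm, ?_⟩
  have hsum : ∑' n, μ (s ∆ (f ⁻¹' B n)) ≠ ⊤ := by
    refine ne_top_of_le_ne_top ?_
      (ENNReal.tsum_le_tsum fun n => (?_ : _ ≤ ENNReal.ofReal ((1 / 2) ^ n)))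
    · rw [← ENNReal.ofReal_tsum_of_nonneg (fun _ => by positivity)
        (summable_geometric_of_lt_one (by norm_num) (by norm_num))]
      exact ENNReal.ofReal_ne_top
    · rw [← ofReal_measureReal]
      exact ENNReal.ofReal_le_ofReal (hB n).le
  filter_upwards [ae_eventually_notMem hsum] with x hx
  refine propext ?_
  change f x ∈ Filter.limsup B Filter.atTop ↔ x ∈ s
  rw [Filter.mem_limsup_iff_frequently_mem]
  constructor
  · intro hf
    obtain ⟨n, hn, hn'⟩ := (hf.and_eventually hx).exists
    by_contra hxs
    exact hn' (Or.inr ⟨hn, hxs⟩)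
  · intro hxs
    refine hx.frequently.mono fun n hn => ?_
    by_contra hn'
    exact hn (Or.inl ⟨hxs, hn'⟩)

/-! ### Isomorphisms with the standard presentation -/

namespace Presentation

open ProbAlg ProbabilityTheory StandardPresentation

variable {P : Presentation} {A : ℕ → Set UnitIco} {hA : ∀ n, MeasurableSet (A n)}

theorem exists_special_eq_mk (P : Presentation) : ∃ A : ℕ → Set UnitIco,
    ∃ hA : ∀ n, MeasurableSet (A n), P.special = fun n => ProbAlg.mk (A n) (hA n) := by
  choose s hs using fun n => SeparationQuotient.surjective_mk (P.special n)
  exact ⟨fun n => (s n).1, fun n => (s n).2, funext fun n => (hs n).symm⟩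

theorem gen_eq_mk (hP : P.special = fun n => ProbAlg.mk (A n) (hA n)) (t : BTerm) :
    P.gen t = ProbAlg.mk (t.setEval A) (BTerm.measurableSet_setEval hA t) := by
  rw [gen, hP, BTerm.eval_mk]

/-- Since the generated points are dense, every Borel set is modulo null sets a preimage under the
function whose digits are the memberships in the special points. -/
theorem generating_digitFunction (hP : P.special = fun n => ProbAlg.mk (A n) (hA n))
    (s : Set UnitIco) (hs : MeasurableSet s) :
    ∃ B : Set ℝ, MeasurableSet B ∧ digitFunction A ⁻¹' B =ᵐ[UnitIco.leb] s := by
  refine exists_preimage_ae_eq_of_approx fun ε hε => ?_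
  obtain ⟨K, hK, hKA⟩ := exists_preimage_digitFunction A
  obtain ⟨_, ht, t, rfl⟩ := Metric.dense_iff.1 P.dense_generated (ProbAlg.mk s hs) ε hε
  refine ⟨t.setEval K, BTerm.measurableSet_setEval hK t, ?_⟩
  rw [BTerm.preimage_setEval, funext hKA]
  change P.gen t ∈ _ at ht
  rw [gen_eq_mk hP, Metric.mem_ball, dist_comm, dist_mk] at ht
  exact ht

section Initial

variable {f : UnitIco → ℝ} [NullSingletonClass (UnitIco.leb.map f)]
  [IsProbabilityMeasure (UnitIco.leb.map f)]

theorem ae_cdfIco_comp_val (hf : Measurable f) : ∀ᵐ x ∂UnitIco.leb,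
    (cdfIco (UnitIco.leb.map f) (f x)).1 = cdf (UnitIco.leb.map f) (f x) :=
  ae_of_ae_map hf.aemeasurable
    ((ae_cdf_mem_Ico (UnitIco.leb.map f)).mono fun _ hy => cdfIco_val _ hy)

/-- The preimage of an initial interval and the preimage of an initial half-line are comparable,
so that their distance is determined by their measures. -/
theorem dist_preimage_interval (hf : Measurable f) (n : ℕ) (y : ℝ) :
    dist (preimage _ (measurePreserving_cdfIco_comp hf)
        (ProbAlg.mk (interval n) (measurableSet_interval n)))
      (ProbAlg.mk (f ⁻¹' Set.Iio y) (hf measurableSet_Iio)) =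
      |((endpoint n).val : ℝ) - cdf (UnitIco.leb.map f) y| := by
  have hm : Measurable (cdf (UnitIco.leb.map f)) := (monotone_cdf _).measurable
  have h : preimage _ (measurePreserving_cdfIco_comp hf)
      (ProbAlg.mk (interval n) (measurableSet_interval n)) =
      ProbAlg.mk (f ⁻¹' (cdf (UnitIco.leb.map f) ⁻¹' Set.Iio ((endpoint n).val : ℝ)))
        (hf (hm measurableSet_Iio)) := by
    rw [preimage_mk]
    refine mk_eq_mk ?_
    filter_upwards [ae_cdfIco_comp_val hf] with x hx
    change ((cdfIco (UnitIco.leb.map f) (f x)).1 < _) =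
      (cdf (UnitIco.leb.map f) (f x) < ((endpoint n).val : ℝ))
    rw [hx]
  have h₁ := meas_preimage (measurePreserving_cdfIco_comp hf)
    (ProbAlg.mk (interval n) (measurableSet_interval n))
  rw [h, meas_mk, meas_mk, real_interval] at h₁
  have hlow : IsLowerSet (cdf (UnitIco.leb.map f) ⁻¹' Set.Iio ((endpoint n).val : ℝ)) :=
    fun a b hba ha => (monotone_cdf _ hba).trans_lt ha
  rw [h, dist_mk_of_subset_or_subset _ _ ((hlow.total (isLowerSet_Iio y)).imp
    (fun h => Set.preimage_mono h) fun h => Set.preimage_mono h), h₁, cdf_eq_real,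
    ← measureReal_congr Iio_ae_eq_Iic, map_measureReal_apply hf measurableSet_Iio]

theorem exists_abs_sub_cdf_lt (hf : Measurable f) {q : ℝ} (h₀ : 0 ≤ q) (h₁ : q < 1) {δ : ℝ}
    (hδ : 0 < δ) : ∃ x, |q - cdf (UnitIco.leb.map f) (f x)| < δ := by
  by_contra! hcon
  have hmin : q < min (q + δ) 1 := lt_min (by linarith) h₁
  have hpos := UnitIco.real_setOf_Ico h₀ hmin.le (min_le_right _ _)
  have hV := measurePreserving_cdfIco_comp hf
  have hm : MeasurableSet {x : UnitIco | x.1 ∈ Set.Ico q (min (q + δ) 1)} :=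
    measurable_subtype_coe measurableSet_Ico
  rw [← hV.measureReal_preimage hm.nullMeasurableSet, measureReal_eq_zero_iff _ |>.2] at hpos
  · linarith
  · refine measure_mono_null (fun x hx => ?_) (ae_cdfIco_comp_val hf)
    intro (hx' : (cdfIco (UnitIco.leb.map f) (f x)).1 = cdf (UnitIco.leb.map f) (f x))
    have hx : (cdfIco (UnitIco.leb.map f) (f x)).1 ∈ Set.Ico q (min (q + δ) 1) := hx
    rw [hx'] at hx
    refine (hcon x).not_gt (abs_lt.2 ⟨?_, ?_⟩)
    · linarith [hx.2.trans_le (min_le_left _ _)]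
    · linarith [hx.1]
  · exact measure_ne_top _ _

end Initial

/-- There is an automorphism that maps the intervals `[0,q)` to the initial segments of the
lexicographic order of the sequences of memberships in the special points; hence the segments given
by terms are at a distance determined by their measures. These measures are dense in `[0,1)`. -/
theorem exists_iso_lexLower (P : Presentation) : ∃ Φ : Iso,
    (∀ n σ, dist (Φ.toEquiv (standard.special n)) (P.gen (BTerm.lexLower 0 σ)) =
      |((endpoint n).val : ℝ) - (P.gen (BTerm.lexLower 0 σ)).meas|) ∧
    ∀ (n : ℕ) (δ : ℝ), 0 < δ →
      ∃ σ, |((endpoint n).val : ℝ) - (P.gen (BTerm.lexLower 0 σ)).meas| < δ := by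
  obtain ⟨A, hA, hP⟩ := P.exists_special_eq_mk
  have hf : Measurable (digitFunction A) := measurable_digitFunction hA
  have hgen := generating_digitFunction hP
  have hprob : IsProbabilityMeasure (UnitIco.leb.map (digitFunction A)) :=
    Measure.isProbabilityMeasure_map hf.aemeasurable
  have hatom := nullSingletonClass_map_of_generating hf hgen
  have hV := measurePreserving_cdfIco_comp hf
  let Φ : Iso := Iso.ofMeasurePreserving _ hV (exists_preimage_cdfIco_comp_ae_eq hf hgen)
  have hlex : ∀ σ : List Bool, P.gen (BTerm.lexLower 0 σ) =
      ProbAlg.mk (digitFunction A ⁻¹' Set.Iio (cantorFunction (1 / 3) (padFalse σ)))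
        (hf measurableSet_Iio) := by
    intro σ
    rw [gen_eq_mk hP]
    refine mk_eq_mk (Filter.EventuallyEq.of_eq (Set.ext fun x => ?_))
    classical
    rw [BTerm.mem_setEval_lexLower (u := fun n => decide (x ∈ A n)) fun n => decide_eq_true_iff]
    simp only [zero_add]
    rw [Set.mem_preimage, Set.mem_Iio, digitFunction]
  have hmeas : ∀ σ : List Bool, (P.gen (BTerm.lexLower 0 σ)).meas =
      cdf (UnitIco.leb.map (digitFunction A)) (cantorFunction (1 / 3) (padFalse σ)) := by
    intro σ
    rw [hlex, meas_mk, cdf_eq_real, ← measureReal_congr Iio_ae_eq_Iic,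
      map_measureReal_apply hf measurableSet_Iio]
  have hdist : ∀ n σ, dist (Φ.toEquiv (standard.special n)) (P.gen (BTerm.lexLower 0 σ)) =
      |((endpoint n).val : ℝ) - (P.gen (BTerm.lexLower 0 σ)).meas| := by
    intro n σ
    rw [hmeas, hlex]
    exact dist_preimage_interval hf n _
  have hex : ∀ (n : ℕ) (δ : ℝ), 0 < δ →
      ∃ σ, |((endpoint n).val : ℝ) - (P.gen (BTerm.lexLower 0 σ)).meas| < δ := by
    intro n δ hδ
    obtain ⟨x, hx⟩ := exists_abs_sub_cdf_lt hf (q := ((endpoint n).val : ℝ))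
      (by exact_mod_cast endpoint_nonneg n) (by exact_mod_cast endpoint_lt_one n) hδ
    simp only [hmeas]
    classical
    have hlim := ((continuous_cdf (UnitIco.leb.map (digitFunction A))).tendsto _).comp
      (tendsto_cantorFunction_padFalse fun n => decide (x ∈ A n))
    have hx' : |((endpoint n).val : ℝ) - cdf (UnitIco.leb.map (digitFunction A))
        (cantorFunction (1 / 3) fun n => decide (x ∈ A n))| < δ := by
      convert! hx
    obtain ⟨k, hk⟩ := ((hlim.const_sub ((endpoint n).val : ℝ)).abs.eventually_lt_const hx').exists
    exact ⟨_, hk⟩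
  exact ⟨Φ, hdist, hex⟩

/-- Every computable presentation is computably isomorphic to the standard one: a segment given by a
term that approximates the image of an interval `[0,q)` is found by searching for one whose measure
is close to `q`. -/
theorem computablyIsomorphic_standard {P : Presentation} (hPc : P.IsComputable) :
    ComputablyIsomorphic standard P := by
  obtain ⟨Φ, hdist, hex⟩ := P.exists_iso_lexLower
  suffices h : IsComputableMap standard P Φ.toEquiv from ⟨Φ, h, h.symm hPc⟩
  obtain ⟨μ, hμ, hμ'⟩ := hPc
  -- The measure is computed to within `ε / 4`. A segment whose computed measure differs from that of
  -- the interval by less than `ε / 2` is then correct, and one whose measure differs from it by less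
  -- than `ε / 4` passes this test.
  let p : ℕ × RatCode → List Bool → Bool := fun a σ =>
    ((μ (BTerm.lexLower 0 σ) (a.2.divSucc 3)).lt ((endpoint a.1).add (a.2.divSucc 1))) &&
    ((endpoint a.1).lt ((μ (BTerm.lexLower 0 σ) (a.2.divSucc 3)).add (a.2.divSucc 1)))
  have hdiv : ∀ d : ℕ, Computable fun a : (ℕ × RatCode) × List Bool => a.1.2.divSucc d := fun d =>
    RatCode.computable_divSucc.comp (Computable.snd.comp Computable.fst) (Computable.const d)
  have hend : Computable fun a : (ℕ × RatCode) × List Bool => endpoint a.1.1 :=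
    computable_endpoint.comp (Computable.fst.comp Computable.fst)
  have hμ₁ : Computable fun a : (ℕ × RatCode) × List Bool =>
      μ (BTerm.lexLower 0 a.2) (a.1.2.divSucc 3) :=
    hμ.comp (BTerm.primrec_lexLower.to_comp.comp Computable.snd) (hdiv 3)
  have hlt₁ : Computable fun a : (ℕ × RatCode) × List Bool =>
      (μ (BTerm.lexLower 0 a.2) (a.1.2.divSucc 3)).lt ((endpoint a.1.1).add (a.1.2.divSucc 1)) :=
    RatCode.computable_lt.comp hμ₁ (RatCode.computable_add.comp hend (hdiv 1))
  have hlt₂ : Computable fun a : (ℕ × RatCode) × List Bool =>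
      (endpoint a.1.1).lt ((μ (BTerm.lexLower 0 a.2) (a.1.2.divSucc 3)).add (a.1.2.divSucc 1)) :=
    RatCode.computable_lt.comp hend (RatCode.computable_add.comp hμ₁ (hdiv 1))
  have hp : Computable₂ p := Primrec.and.to_comp.comp hlt₁ hlt₂
  have hv : ∀ (ε : RatCode) (d : ℕ), ((ε.divSucc d).val : ℝ) = ε.val / (d + 1) := by
    intro ε d; rw [RatCode.val_divSucc]; push_cast; rfl
  have hpos : ∀ (ε : RatCode) (d : ℕ), 0 < ε.val → 0 < (ε.divSucc d).val := by
    intro ε d hε; rw [RatCode.val_divSucc]; positivity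
  have hp_iff : ∀ n ε σ, p (n, ε) σ = true ↔
      |((endpoint n).val : ℝ) - (μ (BTerm.lexLower 0 σ) (ε.divSucc 3)).val| < ε.val / 2 := by
    intro n ε σ
    simp only [p]
    rw [Bool.and_eq_true, RatCode.lt_iff, RatCode.lt_iff, RatCode.val_add, RatCode.val_add,
      ← Rat.cast_lt (K := ℝ), ← Rat.cast_lt (K := ℝ), Rat.cast_add, Rat.cast_add, hv, abs_lt]
    norm_num
    constructor <;> rintro ⟨h₁, h₂⟩ <;> constructor <;> linarith
  have hfind : ∀ a : ℕ × RatCode, a.2.isPos = true → ∃ σ, p a σ = true := by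
    rintro ⟨n, ε⟩ hε
    have hε := (RatCode.isPos_iff _).1 hε
    have hε' : (0 : ℝ) < ε.val := by exact_mod_cast hε
    obtain ⟨σ, hσ⟩ := hex n (ε.val / 4) (by positivity)
    refine ⟨σ, (hp_iff n ε σ).2 ?_⟩
    have h₁ := hμ' (BTerm.lexLower 0 σ) _ (hpos ε 3 hε)
    rw [hv] at h₁
    norm_num at h₁
    rw [abs_lt] at h₁ hσ ⊢
    constructor <;> linarith [h₁.1, h₁.2, hσ.1, hσ.2]
  have hq : Computable fun a : ℕ × RatCode => a.2.isPos :=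
    RatCode.computable_isPos.comp Computable.snd
  obtain ⟨s, hs, hs'⟩ := Computable.exists_search [] hq hp hfind
  have halg : Computable₂ fun (n : ℕ) (ε : RatCode) => BTerm.lexLower 0 (s (n, ε)) :=
    BTerm.primrec_lexLower.to_comp.comp hs
  refine isComputableMap_of_special (fun t => Φ.apply_eval _ t) ⟨_, halg, ?_⟩
  intro n ε hε
  have hε' : (0 : ℝ) < ε.val := by exact_mod_cast hε
  have h₀ := (hp_iff _ _ _).1 (hs' (n, ε) ((RatCode.isPos_iff _).2 hε))
  have h₁ := hμ' (BTerm.lexLower 0 (s (n, ε))) _ (hpos ε 3 hε)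
  rw [hv] at h₁
  norm_num at h₁
  rw [hdist]
  rw [abs_lt] at h₀ h₁ ⊢
  constructor <;> linarith [h₁.1, h₁.2, h₀.1, h₀.2]

end Presentation

theorem mainTheorem2 :
    (∃ P : Presentation, P.IsComputable) ∧
      ∀ P Q : Presentation, P.IsComputable → Q.IsComputable →
        Presentation.ComputablyIsomorphic P Q :=
  ⟨⟨_, StandardPresentation.isComputable_standard⟩, fun _ _ hP hQ =>
    (Presentation.computablyIsomorphic_standard hP).symm.trans
      (Presentation.computablyIsomorphic_standard hQ)⟩
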